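/- Let $n,m\in\mathbb N$, $T\in(0,\infty)$, let $W$ be an $m$-dimensional Brownian motion on $[0,T]$ on a probability space $(\Omega,\mathcal F,P)$, and let $(\mathcal F_s)_{s\in[0,T]}$ be the augmented natural filtration of $W$. Let $O\in\mathbb R^{n\times n}$ be orthogonal, $\lambda_1,\dots,\lambda_n>0$, and $\gamma^{\alpha}=O^\top\operatorname{diag}(\lambda_1^\alpha,\dots,\lambda_n^\alpha)O$ for $\alpha\in\mathbb R$, $\gamma=\gamma^1$. Let $\rho\in\mathbb R^{n\times n}$ be symmetric positive definite with $\rho\gamma=\gamma\rho$, let $x,d\in\mathbb R^n$ with $d\neq\gamma x$, and let $\nu(s)=e^{s\rho}$ and $\kappa=\tfrac12\big(\gamma^{-1/2}\rho\gamma^{1/2}+\gamma^{1/2}\rho^\top\gamma^{-1/2}\big)$. For a progressively measurable $X=(X(s))_{s\in[0,T]}$ with values in $\mathbb R^n$ and $\int_0^T\|X(s)\|^2ds<\infty$ a.s., its deviation is $$D^X(r)=\gamma X(r)+\nu(r)^{-1}\Big(d-\gamma x-\int_0^r\nu(s)\rho\gamma X(s)\,ds\Big),\quad r\in[0,T].$$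 Let $\mathcal A^{pm}_0(x,d)$ be the set of such $X$ (with $X(0-)=x$) that satisfy $X(T)=0$ a.s. and $E\big[\int_0^T\|\gamma^{-1/2}D^X(s)\|^2ds\big]<\infty$, and define on it $$J^{pm}(X)=\tfrac12E\big[D^X(T)^\top\gamma^{-1}D^X(T)\,\big|\,\mathcal F_0\big]+E\Big[\int_0^TD^X(s)^\top\gamma^{-1/2}\kappa\gamma^{-1/2}D^X(s)\,ds\,\Big|\,\mathcal F_0\Big]-\tfrac12d^\top\gamma^{-1}d .$$ Let $\mathcal A^{fv}_0(x,d)$ be the set of adapted càdlàg finite-variation processes $X$ with $X(0-)=x$ and $X(T)=0$ such that the càdlàg finite-variation solution $D$ of $dD(s)=-\rho D(s)\,ds+\gamma\,dX(s)$ on $[0,T]$, $D(0-)=d$ (a jump of $X$ at time $0$ included), satisfies $E\big[\int_0^T\|\gamma^{-1/2}D(s)\|^2ds\big]<\infty$. Then there is a minimizer $X^*$ of $J^{pm}$ over $\mathcal A^{pm}_0(x,d)$ (that is, $J^{pm}(X^*)\le J^{pm}(Y)$ a.s. for all $Y\in\mathcal A^{pm}_0(x,d)$); it is unique up to $dP\times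 ds|_{[0,T]}$-null sets; $X^*\in\mathcal A^{fv}_0(x,d)$; its deviation $D^*=D^{X^*}$ also solves $dD^*(s)=-\rho D^*(s)\,ds+\gamma\,dX^*(s)$, $D^*(0-)=d$; and $$X^*(s)=\big(I_n+(T-s)\rho\big)\big(2I_n+T\rho\big)^{-1}\big(x-\gamma^{-1}d\big),\quad s\in[0,T),$$ $$D^*(s)=\gamma^{1/2}\big(2I_n+T\rho\big)^{-1}\big(\gamma^{-1/2}d-\gamma^{1/2}x\big),\quad s\in[0,T),$$ $$D^*(T)=2\gamma^{1/2}\big(2I_n+T\rho\big)^{-1}\big(\gamma^{-1/2}d-\gamma^{1/2}x\big).$$ -/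

import Mathlib

namespace ObizhaevaWang

open MeasureTheory ProbabilityTheory
open scoped Matrix ENNReal

/-- `ℝⁿ`. Squared Euclidean norms are written `v ⬝ᵥ v`. -/
abbrev Vec (n : ℕ) : Type := Fin n → ℝ

/-- `ℝⁿˣⁿ`. -/
abbrev Mat (n : ℕ) : Type := Matrix (Fin n) (Fin n) ℝ

/-! ### Liquidity parameters -/

/-- The price impact matrix `γ = Oᵀ diag(λ₁, …, λₙ) O`. -/
def impact {n : ℕ} (O : Mat n) (lam : Vec n) : Mat n :=
  Oᵀ * Matrix.diagonal lam * O

/-- The power `γ^α = Oᵀ diag(λ₁^α, …, λₙ^α) O`. -/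
noncomputable def impactPow {n : ℕ} (O : Mat n) (lam : Vec n) (α : ℝ) : Mat n :=
  Oᵀ * Matrix.diagonal (fun j => lam j ^ α) * O

/-- The solution `ν` of `dν(s) = ν(s) ρ ds`, `ν(0) = I`, for a constant matrix `ρ`. -/
noncomputable def nu {n : ℕ} (ρ : Mat n) (s : ℝ) : Mat n :=
  NormedSpace.exp (s • ρ)

theorem nu_zero {n : ℕ} (ρ : Mat n) : nu ρ 0 = 1 := by
  simp [nu]

attribute [local instance] Matrix.linftyOpNormedRing Matrix.linftyOpNormedAlgebra in
theorem hasDerivAt_nu {n : ℕ} (ρ : Mat n) (s : ℝ) :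
    HasDerivAt (nu ρ) (nu ρ s * ρ) s :=
  hasDerivAt_exp_smul_const ρ s

/-- `κ = ½ γ^{-1/2} ρ γ^{1/2} + ½ γ^{1/2} ρᵀ γ^{-1/2}` (price impact without drift and
volatility). -/
noncomputable def kappa {n : ℕ} (O : Mat n) (lam : Vec n) (ρ : Mat n) : Mat n :=
  (1 / 2 : ℝ) • (impactPow O lam (-(1 / 2)) * ρ * impactPow O lam (1 / 2)) +
    (1 / 2 : ℝ) • (impactPow O lam (1 / 2) * ρᵀ * impactPow O lam (-(1 / 2)))

/-! ### Time interval, processes and the Brownian filtration -/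

/-- The time interval `[0,T]`. -/
abbrev Time (T : ℝ) : Type := Set.Icc (0 : ℝ) T

/-- The initial time `0`. -/
def startTime {T : ℝ} (hT : 0 < T) : Time T := ⟨0, le_rfl, hT.le⟩

/-- The terminal time `T`. -/
def endTime {T : ℝ} (hT : 0 < T) : Time T := ⟨T, hT.le, le_rfl⟩

/-- `W` is an `m`-dimensional Brownian motion on `[0,T]` with respect to the filtration `𝓕`. -/
structure IsBrownianMotion {Ω : Type*} {mΩ : MeasurableSpace Ω} (P : Measure Ω) {T : ℝ}
    (hT : 0 < T) (𝓕 : Filtration (Time T) mΩ) {m : ℕ} (W : Time T → Ω → Vec m) : Prop where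
  adapted : ∀ t, Measurable[𝓕 t] (W t)
  start : ∀ᵐ ω ∂P, W (startTime hT) ω = 0
  continuous : ∀ᵐ ω ∂P, Continuous fun t => W t ω
  indep : ∀ s t, s ≤ t →
    Indep (MeasurableSpace.comap (fun ω => W t ω - W s ω) inferInstance) (𝓕 s) P
  law : ∀ s t, s ≤ t → P.map (fun ω => W t ω - W s ω) =
    Measure.pi fun _ => gaussianReal 0 (Real.toNNReal ((t : ℝ) - (s : ℝ)))

/-- `𝓕` is the natural filtration of `W`, augmented by all `P`-null sets. -/
def IsAugmentedNaturalFiltration {Ω : Type*} {mΩ : MeasurableSpace Ω} (P : Measure Ω) {T : ℝ}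
    (𝓕 : Filtration (Time T) mΩ) {m : ℕ} (W : Time T → Ω → Vec m) : Prop :=
  ∀ t, (𝓕 t : MeasurableSpace Ω) =
    (⨆ s ≤ t, MeasurableSpace.comap (W s) inferInstance) ⊔
      MeasurableSpace.generateFrom {N | P N = 0}

/-- The path `s ↦ X(s, ω)` as a function of real time, constant outside `[0,T]`. Only its values
on `[0,T]` enter integrals over subintervals of `[0,T]`. -/
noncomputable def path {Ω : Type*} {T : ℝ} (hT : 0 < T) {n : ℕ} (X : Time T → Ω → Vec n)
    (ω : Ω) : ℝ → Vec n :=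
  Set.IccExtend hT.le fun s => X s ω

/-- The integrability condition `E[∫₀ᵀ ‖γ^{-1/2} D(s)‖² ds] < ∞`. -/
def SquareIntegrableDeviation {Ω : Type*} {mΩ : MeasurableSpace Ω} (P : Measure Ω) {T : ℝ}
    (hT : 0 < T) {n : ℕ} (O : Mat n) (lam : Vec n) (D : Time T → Ω → Vec n) : Prop :=
  ∫⁻ ω, (∫⁻ s in Set.Icc (0 : ℝ) T, ENNReal.ofReal
    ((impactPow O lam (-(1 / 2)) *ᵥ path hT D ω s) ⬝ᵥ
      (impactPow O lam (-(1 / 2)) *ᵥ path hT D ω s))) ∂P < ∞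

/-! ### Progressively measurable strategies -/

/-- The deviation process of a progressively measurable strategy with initial position `x` and
initial deviation `d`,
`D(r) = γ X(r) + ν⁻¹(r) (d - γ x - ∫₀ʳ (d(ν(s) γ)) X(s))`, where `d(ν(s) γ) = ν(s) ρ γ ds`. -/
noncomputable def deviation {Ω : Type*} {T : ℝ} (hT : 0 < T) {n : ℕ} (O : Mat n) (lam : Vec n)
    (ρ : Mat n) (x d : Vec n) (X : Time T → Ω → Vec n) (r : Time T) (ω : Ω) : Vec n :=
  impact O lam *ᵥ X r ω + (nu ρ r)⁻¹ *ᵥ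
    (d - impact O lam *ᵥ x - ∫ s in (0 : ℝ)..r, (nu ρ s * ρ * impact O lam) *ᵥ path hT X ω s)

/-- The set `𝒜₀^{pm}(x,d)` of progressively measurable strategies with terminal target `0`. The
prescribed value `X(0-) = x` enters through the deviation. -/
structure IsPMStrategy {Ω : Type*} {mΩ : MeasurableSpace Ω} (P : Measure Ω) {T : ℝ}
    (hT : 0 < T) (𝓕 : Filtration (Time T) mΩ) {n : ℕ} (O : Mat n) (lam : Vec n) (ρ : Mat n)
    (x d : Vec n) (X : Time T → Ω → Vec n) : Prop where
  progressive : IsStronglyProgressive 𝓕 X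
  square_integrable : ∀ᵐ ω ∂P,
    ∫⁻ s in Set.Icc (0 : ℝ) T, ENNReal.ofReal (path hT X ω s ⬝ᵥ path hT X ω s) < ∞
  terminal : ∀ᵐ ω ∂P, X (endTime hT) ω = 0
  deviation_integrable :
    SquareIntegrableDeviation P hT O lam (deviation hT O lam ρ x d X)

/-- The cost functional
`J^{pm}(x,d,X) = ½ E₀[D(T)ᵀ γ⁻¹ D(T)] + E₀[∫₀ᵀ D(s)ᵀ γ^{-1/2} κ γ^{-1/2} D(s) ds] - ½ dᵀ γ⁻¹ d`
(no risk term), a random variable, `E₀` being the conditional expectation given `𝓕₀`. -/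
noncomputable def costPM {Ω : Type*} {mΩ : MeasurableSpace Ω} (P : Measure Ω) {T : ℝ}
    (hT : 0 < T) (𝓕 : Filtration (Time T) mΩ) {n : ℕ} (O : Mat n) (lam : Vec n) (ρ : Mat n)
    (x d : Vec n) (X : Time T → Ω → Vec n) (ω : Ω) : ℝ :=
  let D := deviation hT O lam ρ x d X
  (1 / 2) * (P[fun ω' => D (endTime hT) ω' ⬝ᵥ (impactPow O lam (-1) *ᵥ D (endTime hT) ω') |
      𝓕 (startTime hT)]) ω +
    (P[fun ω' => ∫ s in (0 : ℝ)..T, path hT D ω' s ⬝ᵥ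
      ((impactPow O lam (-(1 / 2)) * kappa O lam ρ * impactPow O lam (-(1 / 2))) *ᵥ
        path hT D ω' s) | 𝓕 (startTime hT)]) ω -
    (1 / 2) * (d ⬝ᵥ (impactPow O lam (-1) *ᵥ d))

/-- `X` minimizes `J^{pm}` over `𝒜₀^{pm}(x,d)`. -/
def IsOptimalPM {Ω : Type*} {mΩ : MeasurableSpace Ω} (P : Measure Ω) {T : ℝ}
    (hT : 0 < T) (𝓕 : Filtration (Time T) mΩ) {n : ℕ} (O : Mat n) (lam : Vec n) (ρ : Mat n)
    (x d : Vec n) (X : Time T → Ω → Vec n) : Prop :=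
  IsPMStrategy P hT 𝓕 O lam ρ x d X ∧
    ∀ Y, IsPMStrategy P hT 𝓕 O lam ρ x d Y →
      costPM P hT 𝓕 O lam ρ x d X ≤ᵐ[P] costPM P hT 𝓕 O lam ρ x d Y

/-! ### Finite-variation strategies -/

/-- The path of `X` preceded by the value `X(0-) = x` at all negative times, so that a jump of
size `X(0) - x` at time `0` is part of the path. -/
noncomputable def pathFrom {Ω : Type*} {T : ℝ} (hT : 0 < T) {n : ℕ} (x : Vec n)
    (X : Time T → Ω → Vec n) (ω : Ω) : ℝ → Vec n :=
  fun s => if s < 0 then x else path hT X ω s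

/-- `X` is an adapted càdlàg finite-variation process with `X(0-) = x`. The left limits exist
because the paths have bounded variation. -/
structure IsCadlagFV {Ω : Type*} {mΩ : MeasurableSpace Ω} {T : ℝ} (hT : 0 < T)
    (𝓕 : Filtration (Time T) mΩ) {n : ℕ} (x : Vec n) (X : Time T → Ω → Vec n) : Prop where
  adapted : ∀ t, Measurable[𝓕 t] (X t)
  right_continuous : ∀ ω s, ContinuousWithinAt (pathFrom hT x X ω) (Set.Ici s) s
  finite_variation : ∀ ω, BoundedVariationOn (pathFrom hT x X ω) Set.univ

open Classical in
/-- The Lebesgue–Stieltjes integral `∫_S A(s) df(s)` of a matrix-valued integrand against a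
function `f` of bounded variation; jumps of `f` at points of `S` contribute. -/
noncomputable def stieltjesIntegral {n : ℕ} (S : Set ℝ) (A : ℝ → Mat n) (f : ℝ → Vec n) : Vec n :=
  if h : BoundedVariationOn f Set.univ then
    ∫ᵛ s in S, LinearMap.toContinuousLinearMap (Matrix.mulVecLin (A s))
      ∂[ContinuousLinearMap.id ℝ (Vec n →L[ℝ] Vec n); h.vectorMeasure]
  else 0

/-- `D` is the càdlàg finite-variation solution of
`dD(s) = -ρ D(s) ds + γ dX(s)`, `s ∈ [0,T]`, `D(0-) = d`. -/
def IsDeviationFV {Ω : Type*} {mΩ : MeasurableSpace Ω} {T : ℝ} (hT : 0 < T)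
    (𝓕 : Filtration (Time T) mΩ) {n : ℕ} (O : Mat n) (lam : Vec n) (ρ : Mat n)
    (x d : Vec n) (X D : Time T → Ω → Vec n) : Prop :=
  IsCadlagFV hT 𝓕 d D ∧
    ∀ ω (r : Time T), D r ω = d - (∫ s in (0 : ℝ)..r, ρ *ᵥ path hT D ω s) +
      stieltjesIntegral (Set.Icc 0 (r : ℝ)) (fun _ => impact O lam) (pathFrom hT x X ω)

/-- The set `𝒜₀^{fv}(x,d)` of finite-variation strategies with terminal target `0`. (The second
integrability condition of the general model, which involves the volatility of the price impact,
is void for constant price impact.) -/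
structure IsFVStrategy {Ω : Type*} {mΩ : MeasurableSpace Ω} (P : Measure Ω) {T : ℝ}
    (hT : 0 < T) (𝓕 : Filtration (Time T) mΩ) {n : ℕ} (O : Mat n) (lam : Vec n) (ρ : Mat n)
    (x d : Vec n) (X : Time T → Ω → Vec n) : Prop where
  cadlagFV : IsCadlagFV hT 𝓕 x X
  terminal : ∀ ω, X (endTime hT) ω = 0
  deviation_integrable : ∃ D, IsDeviationFV hT 𝓕 O lam ρ x d X D ∧
    SquareIntegrableDeviation P hT O lam D

end ObizhaevaWang

/-!
Variation of constants turns the definition of the deviation into the Volterra equation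
`D(r) = γ X(r) + d - γ x - ∫₀ʳ ρ D(s) ds`. Since `X(T) = 0`, the scaled deviation `z = γ^{-1/2} D`
satisfies `z(T) = b - ρ ∫₀ᵀ z(s) ds` with `b = γ^{-1/2} (d - γ x)`, and since `ρ` commutes with `γ`
we have `κ = ρ`. Hence, up to a constant, the cost is the conditional expectation of the convex
quadratic functional `½ ‖b - ρ ∫ z‖² + ∫ zᵀ ρ z` of the path of `z`. Its first-order condition
`b - ρ ∫ z = 2 z(s)` forces the minimiser to be the constant path `c` with `(2 + T ρ) c = b`, and
completing the square around `c` gives minimality and uniqueness.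
-/

namespace ObizhaevaWang

open MeasureTheory ProbabilityTheory Filter Topology
open scoped Matrix ENNReal

/-! ### Matrices -/

section Matrix

variable {ι : Type*} [Fintype ι]

theorem dotProduct_mulVec_comm {R : Type*} [CommSemiring R] {A : Matrix ι ι R} (hA : A.IsSymm)
    (v w : ι → R) : v ⬝ᵥ (A *ᵥ w) = w ⬝ᵥ (A *ᵥ v) := by
  rw [Matrix.dotProduct_mulVec, ← Matrix.mulVec_transpose, hA.eq, dotProduct_comm]

theorem dotProduct_mul_mul_mulVec {R : Type*} [CommSemiring R] {A : Matrix ι ι R} (hA : A.IsSymm)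
    (B : Matrix ι ι R) (v : ι → R) :
    v ⬝ᵥ ((A * B * A) *ᵥ v) = (A *ᵥ v) ⬝ᵥ (B *ᵥ (A *ᵥ v)) := by
  rw [Matrix.mul_assoc, ← Matrix.mulVec_mulVec, ← Matrix.mulVec_mulVec,
    dotProduct_mulVec_comm hA v, dotProduct_comm]

theorem eq_zero_of_dotProduct_mulVec_eq_zero {A : Matrix ι ι ℝ} (hA : A.PosDef) {v : ι → ℝ}
    (h : v ⬝ᵥ (A *ᵥ v) = 0) : v = 0 := by
  by_contra hv
  simpa [h] using hA.dotProduct_mulVec_pos hv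

variable [DecidableEq ι]

theorem commute_nonsing_inv {R : Type*} [CommRing R] {A B : Matrix ι ι R} (h : Commute A B) :
    Commute A B⁻¹ := by
  by_cases hB : IsUnit B.det
  · calc A * B⁻¹ = B⁻¹ * (B * A) * B⁻¹ := by
          rw [← Matrix.mul_assoc, Matrix.nonsing_inv_mul _ hB, Matrix.one_mul]
      _ = B⁻¹ * A := by
          rw [← h.eq, Matrix.mul_assoc, Matrix.mul_nonsing_inv_cancel_right _ _ hB]
  · rw [Matrix.nonsing_inv_apply_not_isUnit _ hB]
    exact Commute.zero_right A

theorem commute_diagonal_comp {R : Type*} [CommRing R] [IsDomain R] {A : Matrix ι ι R}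
    {v : ι → R} (h : Commute A (Matrix.diagonal v)) (g : R → R) :
    Commute A (Matrix.diagonal (g ∘ v)) := by
  ext i j
  have hij := congrFun₂ h.eq i j
  rw [Matrix.mul_diagonal, Matrix.diagonal_mul, mul_comm] at hij ⊢
  rcases eq_or_ne (A i j) 0 with hA | hA
  · simp [hA]
  · simp [mul_right_cancel₀ hA hij]

theorem isUnit_det_smul_one_add_smul {A : Matrix ι ι ℝ} (hA : A.PosSemidef) {a t : ℝ} (ha : 0 < a)
    (ht : 0 ≤ t) : IsUnit (a • (1 : Matrix ι ι ℝ) + t • A).det :=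
  (Matrix.isUnit_iff_isUnit_det _).1 ((Matrix.PosDef.one.smul ha).add_posSemidef
    (hA.smul ht)).isUnit

end Matrix

/-! ### Powers of the price impact matrix -/

section Impact

variable {n : ℕ} {O : Mat n} {lam : Vec n} {ρ : Mat n}

theorem impactPow_one (O : Mat n) (lam : Vec n) : impactPow O lam 1 = impact O lam := by
  simp [impactPow, impact]

theorem isSymm_impactPow (O : Mat n) (lam : Vec n) (α : ℝ) : (impactPow O lam α).IsSymm := by
  simp [Matrix.IsSymm, impactPow, Matrix.transpose_mul, Matrix.mul_assoc]

theorem mul_transpose_of_orthogonal (hO : O ∈ Matrix.orthogonalGroup (Fin n) ℝ) :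
    O * Oᵀ = 1 := by
  simpa [Matrix.star_eq_conjTranspose] using (Matrix.mem_orthogonalGroup_iff (Fin n) ℝ).1 hO

theorem transpose_mul_of_orthogonal (hO : O ∈ Matrix.orthogonalGroup (Fin n) ℝ) :
    Oᵀ * O = 1 := by
  simpa [Matrix.star_eq_conjTranspose] using (Matrix.mem_orthogonalGroup_iff' (Fin n) ℝ).1 hO

theorem impactPow_zero (hO : O ∈ Matrix.orthogonalGroup (Fin n) ℝ) (lam : Vec n) :
    impactPow O lam 0 = 1 := by
  simp [impactPow, transpose_mul_of_orthogonal hO]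

theorem conj_mul_conj_of_orthogonal (hO : O ∈ Matrix.orthogonalGroup (Fin n) ℝ)
    (A B : Mat n) : (Oᵀ * A * O) * (Oᵀ * B * O) = Oᵀ * (A * B) * O := by
  calc (Oᵀ * A * O) * (Oᵀ * B * O) = Oᵀ * A * (O * Oᵀ) * B * O := by
        simp only [Matrix.mul_assoc]
    _ = Oᵀ * (A * B) * O := by
        rw [mul_transpose_of_orthogonal hO, Matrix.mul_one, Matrix.mul_assoc Oᵀ]

theorem impactPow_mul_impactPow (hO : O ∈ Matrix.orthogonalGroup (Fin n) ℝ)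
    (hlam : ∀ j, 0 < lam j) (α β : ℝ) :
    impactPow O lam α * impactPow O lam β = impactPow O lam (α + β) := by
  rw [impactPow, impactPow, conj_mul_conj_of_orthogonal hO,
    Matrix.diagonal_mul_diagonal]
  simp only [impactPow, Real.rpow_add (hlam _)]

theorem impactPow_mulVec_impactPow_mulVec (hO : O ∈ Matrix.orthogonalGroup (Fin n) ℝ)
    (hlam : ∀ j, 0 < lam j) (α β : ℝ) (v : Vec n) :
    impactPow O lam α *ᵥ (impactPow O lam β *ᵥ v) = impactPow O lam (α + β) *ᵥ v := by
  rw [Matrix.mulVec_mulVec, impactPow_mul_impactPow hO hlam]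

theorem impactPow_mulVec_injective (hO : O ∈ Matrix.orthogonalGroup (Fin n) ℝ)
    (hlam : ∀ j, 0 < lam j) (α : ℝ) : Function.Injective (impactPow O lam α *ᵥ ·) :=
  Function.LeftInverse.injective (g := (impactPow O lam (-α) *ᵥ ·)) fun v => by
    simp only [impactPow_mulVec_impactPow_mulVec hO hlam, neg_add_cancel, impactPow_zero hO,
      Matrix.one_mulVec]

theorem dotProduct_impactPow_mulVec (hO : O ∈ Matrix.orthogonalGroup (Fin n) ℝ)
    (hlam : ∀ j, 0 < lam j) (α : ℝ) (v : Vec n) :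
    v ⬝ᵥ (impactPow O lam α *ᵥ v) =
      (impactPow O lam (α / 2) *ᵥ v) ⬝ᵥ (impactPow O lam (α / 2) *ᵥ v) := by
  have hsplit := dotProduct_mul_mul_mulVec (isSymm_impactPow O lam (α / 2)) 1 v
  rwa [Matrix.mul_one, impactPow_mul_impactPow hO hlam, add_halves, Matrix.one_mulVec] at hsplit

theorem commute_impactPow (hO : O ∈ Matrix.orthogonalGroup (Fin n) ℝ)
    (hcomm : Commute ρ (impact O lam)) (α : ℝ) : Commute ρ (impactPow O lam α) := by
  have hρ : ρ = Oᵀ * (O * ρ * Oᵀ) * O := by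
    calc ρ = (Oᵀ * O) * ρ * (Oᵀ * O) := by
          rw [transpose_mul_of_orthogonal hO, Matrix.one_mul, Matrix.mul_one]
      _ = Oᵀ * (O * ρ * Oᵀ) * O := by simp only [Matrix.mul_assoc]
  have hdiag : Commute (O * ρ * Oᵀ) (Matrix.diagonal lam) := by
    have hO' : Oᵀ ∈ Matrix.orthogonalGroup (Fin n) ℝ :=
      (Matrix.mem_orthogonalGroup_iff (Fin n) ℝ).2 (by
        simpa [Matrix.star_eq_conjTranspose] using transpose_mul_of_orthogonal hO)
    have hlam : Matrix.diagonal lam = O * impact O lam * Oᵀ := by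
      calc Matrix.diagonal lam = (O * Oᵀ) * Matrix.diagonal lam * (O * Oᵀ) := by
            rw [mul_transpose_of_orthogonal hO, Matrix.one_mul, Matrix.mul_one]
        _ = O * impact O lam * Oᵀ := by simp only [impact, Matrix.mul_assoc]
    rw [hlam]
    have h := conj_mul_conj_of_orthogonal hO'
    simp only [Matrix.transpose_transpose] at h
    rw [commute_iff_eq, h, h, hcomm.eq]
  rw [hρ, commute_iff_eq, impactPow, conj_mul_conj_of_orthogonal hO,
    conj_mul_conj_of_orthogonal hO]
  exact congrArg (Oᵀ * · * O) (commute_diagonal_comp hdiag (· ^ α)).eq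

theorem kappa_eq_self (hO : O ∈ Matrix.orthogonalGroup (Fin n) ℝ) (hlam : ∀ j, 0 < lam j)
    (hcomm : Commute ρ (impact O lam)) (hsymm : ρ.IsSymm) : kappa O lam ρ = ρ := by
  have h := commute_impactPow hO hcomm
  rw [kappa, hsymm.eq, ← (h (-(1 / 2))).eq, ← (h (1 / 2)).eq, Matrix.mul_assoc, Matrix.mul_assoc,
    impactPow_mul_impactPow hO hlam, impactPow_mul_impactPow hO hlam, neg_add_cancel,
    add_neg_cancel, impactPow_zero hO, Matrix.mul_one, ← add_smul]
  norm_num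

end Impact

/-! ### Integrals of vector-valued functions -/

section Calculus

variable {ι κ : Type*} [Fintype ι] [Fintype κ]

theorem integral_mulVec {α : Type*} {_ : MeasurableSpace α} {μ : Measure α}
    (A : Matrix κ ι ℝ) {f : α → ι → ℝ} (hf : Integrable f μ) :
    ∫ a, A *ᵥ f a ∂μ = A *ᵥ ∫ a, f a ∂μ :=
  (LinearMap.toContinuousLinearMap (Matrix.mulVecLin A)).integral_comp_comm hf

theorem intervalIntegral_eq_integral_Icc {E : Type*} [NormedAddCommGroup E] [NormedSpace ℝ E]
    {a b : ℝ} (hab : a ≤ b) (f : ℝ → E) : ∫ s in a..b, f s = ∫ s in Set.Icc a b, f s := by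
  rw [intervalIntegral.integral_of_le hab, integral_Icc_eq_integral_Ioc]

theorem intervalIntegral_apply {f : ℝ → ι → ℝ} {a b : ℝ} (hf : IntervalIntegrable f volume a b)
    (i : ι) : (∫ s in a..b, f s) i = ∫ s in a..b, f s i :=
  ((ContinuousLinearMap.proj (R := ℝ) (φ := fun _ : ι => ℝ) i).intervalIntegral_comp_comm hf).symm

theorem intervalIntegrable_pi_iff {f : ℝ → ι → ℝ} {a b : ℝ} :
    IntervalIntegrable f volume a b ↔
      ∀ i, IntervalIntegrable (fun s => f s i) volume a b :=
  ⟨fun hf i => ⟨hf.1.eval i, hf.2.eval i⟩,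
    fun hf => ⟨Integrable.of_eval fun i => (hf i).1, Integrable.of_eval fun i => (hf i).2⟩⟩

theorem intervalIntegrable_mulVec {A : ℝ → Matrix κ ι ℝ} (hA : Continuous A) {f : ℝ → ι → ℝ}
    {a b : ℝ} (hf : IntervalIntegrable f volume a b) :
    IntervalIntegrable (fun s => A s *ᵥ f s) volume a b := by
  refine intervalIntegrable_pi_iff.2 fun i => ?_
  have hterm : ∀ j ∈ Finset.univ, IntervalIntegrable (fun s => A s i j * f s j) volume a b :=
    fun j _ => (intervalIntegrable_pi_iff.1 hf j).continuousOn_mul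
      (hA.matrix_elem i j).continuousOn
  simpa [Matrix.mulVec, dotProduct, Finset.sum_fn] using IntervalIntegrable.sum _ hterm

theorem intervalIntegrable_sub_primitive {E : Type*} [NormedAddCommGroup E] [NormedSpace ℝ E]
    {φ : ℝ → E} {a r : ℝ} (c : E) (hφ : IntervalIntegrable φ volume a r) :
    IntervalIntegrable (fun s => c - ∫ u in a..s, φ u) volume a r :=
  (continuousOn_const.sub (intervalIntegral.continuousOn_primitive_interval' hφ
    Set.left_mem_uIcc)).intervalIntegrable

theorem mul_sub_integral_eq {f f' φ : ℝ → ℝ} {a r : ℝ} (c : ℝ)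
    (hf : ∀ s, HasDerivAt f (f' s) s) (hf' : Continuous f')
    (hφ : IntervalIntegrable φ volume a r) :
    f r * (c - ∫ s in a..r, φ s) =
      f a * c + ∫ s in a..r, (f' s * (c - ∫ u in a..s, φ u) - f s * φ s) := by
  have hderiv : deriv f = f' := funext fun s => (hf s).deriv
  have hfC1 : ContDiff ℝ 1 f :=
    contDiff_one_iff_deriv.2 ⟨fun s => (hf s).differentiableAt, hderiv ▸ hf'⟩
  have hprim : AbsolutelyContinuousOnInterval (fun s => c - ∫ u in a..s, φ u) a r :=
    (contDiff_const (c := c) (n := 1)).contDiffOn.absolutelyContinuousOnInterval.sub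
      (hφ.absolutelyContinuousOnInterval_intervalIntegral Set.left_mem_uIcc)
  have hparts := hfC1.contDiffOn.absolutelyContinuousOnInterval.integral_deriv_mul_eq_sub hprim
  have hintegrand : ∫ s in a..r, (f' s * (c - ∫ u in a..s, φ u) - f s * φ s) =
      ∫ s in a..r, deriv f s * (c - ∫ u in a..s, φ u) +
        f s * deriv (fun s => c - ∫ u in a..s, φ u) s := by
    refine intervalIntegral.integral_congr_ae ?_
    filter_upwards [hφ.ae_hasDerivAt_integral] with s hs hmem
    rw [((hs (Set.uIoc_subset_uIcc hmem) a Set.left_mem_uIcc).const_sub c).deriv, hderiv]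
    ring
  rw [hintegrand, hparts, intervalIntegral.integral_same]
  ring

theorem mulVec_sub_integral_eq {N N' : ℝ → Matrix κ ι ℝ} {φ : ℝ → ι → ℝ} {a r : ℝ} (c : ι → ℝ)
    (hN : ∀ s i j, HasDerivAt (fun t => N t i j) (N' s i j) s) (hN' : Continuous N')
    (hφ : IntervalIntegrable φ volume a r) :
    N r *ᵥ (c - ∫ s in a..r, φ s) =
      N a *ᵥ c + ∫ s in a..r, (N' s *ᵥ (c - ∫ u in a..s, φ u) - N s *ᵥ φ s) := by
  have hNc : Continuous N := continuous_matrix fun i j =>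
    continuous_iff_continuousAt.2 fun s => (hN s i j).continuousAt
  have hφj : ∀ j, IntervalIntegrable (fun s => φ s j) volume a r := intervalIntegrable_pi_iff.1 hφ
  have hcoord : ∀ s ∈ Set.uIcc a r, ∀ j, (∫ u in a..s, φ u) j = ∫ u in a..s, φ u j :=
    fun s hs j => intervalIntegral_apply
      (hφ.mono_set (Set.uIcc_subset_uIcc Set.left_mem_uIcc hs)) j
  have hterm : ∀ i, ∀ j ∈ Finset.univ, IntervalIntegrable
      (fun s => N' s i j * (c j - ∫ u in a..s, φ u j) - N s i j * φ s j) volume a r :=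
    fun i j _ => ((intervalIntegrable_sub_primitive (c j) (hφj j)).continuousOn_mul
      (hN'.matrix_elem i j).continuousOn).sub
        ((hφj j).continuousOn_mul (hNc.matrix_elem i j).continuousOn)
  ext i
  calc (N r *ᵥ (c - ∫ s in a..r, φ s)) i
      = ∑ j, N r i j * (c j - ∫ s in a..r, φ s j) := by
        simp only [Matrix.mulVec, dotProduct, Pi.sub_apply, hcoord r Set.right_mem_uIcc]
    _ = ∑ j, N a i j * c j +
          ∫ s in a..r, ∑ j, (N' s i j * (c j - ∫ u in a..s, φ u j) - N s i j * φ s j) := by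
        rw [intervalIntegral.integral_finsetSum (hterm i), ← Finset.sum_add_distrib]
        exact Finset.sum_congr rfl fun j _ =>
          mul_sub_integral_eq (c j) (fun s => hN s i j) (hN'.matrix_elem i j) (hφj j)
    _ = (N a *ᵥ c + ∫ s in a..r, (N' s *ᵥ (c - ∫ u in a..s, φ u) - N s *ᵥ φ s)) i := by
        rw [Pi.add_apply, intervalIntegral_apply ((intervalIntegrable_mulVec hN'
          (intervalIntegrable_sub_primitive c hφ)).sub (intervalIntegrable_mulVec hNc hφ))]
        congr 1
        refine intervalIntegral.integral_congr fun s hs => ?_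
        simp [Matrix.mulVec, dotProduct, hcoord s hs, Finset.sum_sub_distrib]

end Calculus

/-! ### Square-integrability -/

section SquareIntegrable

variable {ι κ : Type*} [Fintype ι] [Fintype κ] {α β : Type*} {mα : MeasurableSpace α}
  {mβ : MeasurableSpace β} {μ : Measure α} {ν : Measure β}

theorem memLp_two_of_lintegral_dotProduct_self_lt_top {f : α → ι → ℝ} (hf : Measurable f)
    (hfin : ∫⁻ a, ENNReal.ofReal (f a ⬝ᵥ f a) ∂μ < ∞) : MemLp f 2 μ := by
  refine MemLp.of_eval fun i => ?_
  have hfi : Measurable fun a => f a i := (measurable_pi_apply i).comp hf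
  refine (memLp_two_iff_integrable_sq hfi.aestronglyMeasurable).2
    ⟨(hfi.pow_const 2).aestronglyMeasurable, ?_⟩
  rw [hasFiniteIntegral_iff_ofReal (ae_of_all _ fun a => sq_nonneg _)]
  refine (lintegral_mono fun a => ENNReal.ofReal_le_ofReal ?_).trans_lt hfin
  rw [sq]
  exact Finset.single_le_sum (f := fun i => f a i * f a i) (fun _ _ => mul_self_nonneg _)
    (Finset.mem_univ i)

theorem memLp_mulVec {p : ℝ≥0∞} {f : α → ι → ℝ} (hf : MemLp f p μ) (A : Matrix κ ι ℝ) :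
    MemLp (fun a => A *ᵥ f a) p μ :=
  (LinearMap.toContinuousLinearMap (Matrix.mulVecLin A)).comp_memLp' hf

theorem integrable_dotProduct {f g : α → ι → ℝ} (hf : MemLp f 2 μ) (hg : MemLp g 2 μ) :
    Integrable (fun a => f a ⬝ᵥ g a) μ :=
  integrable_finsetSum _ fun i _ => (hf.eval i).integrable_mul (hg.eval i)

theorem memLp_integral_prod {E : Type*} [NormedAddCommGroup E] [NormedSpace ℝ E] {p : ℝ≥0∞}
    (hp : 1 ≤ p) (hp_top : p ≠ ∞) [IsFiniteMeasure ν] {f : α × β → E}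
    (hf : MemLp f p (μ.prod ν)) : MemLp (fun a => ∫ b, f (a, b) ∂ν) p μ := by
  have hp0 : p ≠ 0 := (one_pos.trans_le hp).ne'
  set q := p.toReal with hq_def
  have hq : 1 ≤ q := by simpa using ENNReal.toReal_mono hp_top hp
  have hq0 : 0 < q := one_pos.trans_le hq
  set C := ν Set.univ ^ (1 - 1 / q)
  refine ⟨hf.1.integral_prod_right', ?_⟩
  have hslice : ∀ᵐ a ∂μ, ‖∫ b, f (a, b) ∂ν‖ₑ ^ q ≤ C ^ q * ∫⁻ b, ‖f (a, b)‖ₑ ^ q ∂ν := by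
    filter_upwards [hf.1.prodMk_left] with a ha
    calc ‖∫ b, f (a, b) ∂ν‖ₑ ^ q
        ≤ (eLpNorm (fun b => f (a, b)) p ν * C) ^ q := by
          refine ENNReal.rpow_le_rpow ((enorm_integral_le_lintegral_enorm _).trans ?_) hq0.le
          rw [← eLpNorm_one_eq_lintegral_enorm]
          simpa [C, q] using eLpNorm_le_eLpNorm_mul_rpow_measure_univ hp ha
      _ = C ^ q * ∫⁻ b, ‖f (a, b)‖ₑ ^ q ∂ν := by
          rw [ENNReal.mul_rpow_of_nonneg _ _ hq0.le, mul_comm,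
            eLpNorm_eq_lintegral_rpow_enorm_toReal hp0 hp_top, ← hq_def,
            ← ENNReal.rpow_mul _ (1 / q), one_div_mul_cancel hq0.ne', ENNReal.rpow_one]
  have hC : C ^ q ≠ ∞ := ENNReal.rpow_ne_top_of_nonneg hq0.le
    (ENNReal.rpow_ne_top_of_nonneg (sub_nonneg.2 ((div_le_one hq0).2 hq)) (measure_ne_top ν _))
  rw [eLpNorm_lt_top_iff_lintegral_rpow_enorm_lt_top hp0 hp_top]
  calc ∫⁻ a, ‖∫ b, f (a, b) ∂ν‖ₑ ^ q ∂μ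
      ≤ ∫⁻ a, C ^ q * ∫⁻ b, ‖f (a, b)‖ₑ ^ q ∂ν ∂μ := lintegral_mono_ae hslice
    _ = C ^ q * ∫⁻ z, ‖f z‖ₑ ^ q ∂(μ.prod ν) := by
        rw [lintegral_const_mul' _ _ hC, lintegral_prod _ (hf.1.enorm.pow_const q)]
    _ < ∞ := ENNReal.mul_lt_top hC.lt_top
        ((eLpNorm_lt_top_iff_lintegral_rpow_enorm_lt_top hp0 hp_top).1 hf.2)

theorem memLp_prodMk_left {E : Type*} [NormedAddCommGroup E] {p : ℝ≥0∞} (hp_top : p ≠ ∞)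
    [SFinite ν] {f : α × β → E} (hf : MemLp f p (μ.prod ν)) :
    ∀ᵐ a ∂μ, MemLp (fun b => f (a, b)) p ν := by
  rcases eq_or_ne p 0 with rfl | hp0
  · simpa only [memLp_zero_iff_aestronglyMeasurable] using hf.1.prodMk_left
  have hfin : ∫⁻ z, ‖f z‖ₑ ^ p.toReal ∂(μ.prod ν) < ∞ :=
    (eLpNorm_lt_top_iff_lintegral_rpow_enorm_lt_top hp0 hp_top).1 hf.2
  have hmeas : AEMeasurable (fun z => ‖f z‖ₑ ^ p.toReal) (μ.prod ν) := hf.1.enorm.pow_const _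
  rw [lintegral_prod _ hmeas] at hfin
  filter_upwards [hf.1.prodMk_left, ae_lt_top' hmeas.lintegral_prod_right' hfin.ne] with a ha hfina
  exact ⟨ha, (eLpNorm_lt_top_iff_lintegral_rpow_enorm_lt_top hp0 hp_top).2 hfina⟩

end SquareIntegrable

/-! ### The matrix exponential and variation of constants -/

section VariationOfConstants

variable {n : ℕ}

theorem inv_nu (ρ : Mat n) (s : ℝ) : (nu ρ s)⁻¹ = nu ρ (-s) := by
  simp [nu, Matrix.exp_neg]

theorem nu_neg_mul_nu (ρ : Mat n) (s : ℝ) : nu ρ (-s) * nu ρ s = 1 := by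
  rw [← inv_nu]
  exact Matrix.nonsing_inv_mul _ ((Matrix.isUnit_iff_isUnit_det _).1 (Matrix.isUnit_exp _))

theorem commute_nu {ρ A : Mat n} (h : Commute ρ A) (s : ℝ) : Commute (nu ρ s) A :=
  (h.smul_left s).exp_left

attribute [local instance] Matrix.linftyOpNormedRing Matrix.linftyOpNormedAlgebra in
theorem hasDerivAt_nu_apply (ρ : Mat n) (s : ℝ) (i j : Fin n) :
    HasDerivAt (fun t => nu ρ t i j) ((nu ρ s * ρ) i j) s :=
  (LinearMap.toContinuousLinearMap
    (Matrix.entryLinearMap ℝ ℝ i j)).hasFDerivAt.comp_hasDerivAt s (hasDerivAt_nu ρ s)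

theorem continuous_nu (ρ : Mat n) : Continuous (nu ρ) :=
  continuous_matrix fun i j => continuous_iff_continuousAt.2 fun s =>
    (hasDerivAt_nu_apply ρ s i j).continuousAt

theorem continuous_nu_mul (ρ : Mat n) : Continuous fun s => nu ρ s * ρ :=
  (continuous_nu ρ).matrix_mul continuous_const

/-- The variation-of-constants formula for the Volterra equation
`D(r) = g(r) + c - ∫₀ʳ ρ D(s) ds`. With `g = γ X` and `c = d - γ x` it is the deviation of `X`. -/
noncomputable def variationOfConstants (ρ : Mat n) (c : Vec n) (g : ℝ → Vec n) (r : ℝ) : Vec n :=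
  g r + (nu ρ r)⁻¹ *ᵥ (c - ∫ s in (0 : ℝ)..r, (nu ρ s * ρ) *ᵥ g s)

variable (ρ : Mat n) (c : Vec n) {g : ℝ → Vec n} {r : ℝ}

theorem intervalIntegrable_variationOfConstants (hg : IntervalIntegrable g volume 0 r) :
    IntervalIntegrable (variationOfConstants ρ c g) volume 0 r := by
  have hinv : Continuous fun s => (nu ρ s)⁻¹ := by
    simp only [inv_nu]
    exact (continuous_nu ρ).comp continuous_neg
  exact hg.add (intervalIntegrable_mulVec hinv (intervalIntegrable_sub_primitive c
    (intervalIntegrable_mulVec (continuous_nu_mul ρ) hg)))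

theorem variationOfConstants_eq_sub_integral (hg : IntervalIntegrable g volume 0 r) :
    variationOfConstants ρ c g r =
      g r + c - ∫ s in (0 : ℝ)..r, ρ *ᵥ variationOfConstants ρ c g s := by
  have hderiv : ∀ s i j,
      HasDerivAt (fun t => nu ρ (-t) i j) ((-(nu ρ (-s) * ρ) : Mat n) i j) s := fun s i j => by
    simpa [Function.comp_def] using (hasDerivAt_nu_apply ρ (-s) i j).comp s (hasDerivAt_neg s)
  have hcont : Continuous fun s => -(nu ρ (-s) * ρ) :=
    ((continuous_nu_mul ρ).comp continuous_neg).neg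
  have hparts := mulVec_sub_integral_eq c hderiv hcont
    (intervalIntegrable_mulVec (continuous_nu_mul ρ) hg)
  have hintegrand : ∀ s, -(nu ρ (-s) * ρ) *ᵥ (c - ∫ u in (0 : ℝ)..s, (nu ρ u * ρ) *ᵥ g u) -
      nu ρ (-s) *ᵥ ((nu ρ s * ρ) *ᵥ g s) = -(ρ *ᵥ variationOfConstants ρ c g s) := fun s => by
    rw [variationOfConstants, inv_nu, Matrix.mulVec_add, Matrix.mulVec_mulVec _ (nu ρ (-s)),
      ← Matrix.mul_assoc, nu_neg_mul_nu, Matrix.one_mul, Matrix.neg_mulVec,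
      (commute_nu (Commute.refl ρ) (-s)).eq, ← Matrix.mulVec_mulVec]
    abel
  simp only [hintegrand, neg_zero, nu_zero, Matrix.one_mulVec, intervalIntegral.integral_neg]
    at hparts
  rw [variationOfConstants, inv_nu, hparts]
  abel

theorem variationOfConstants_eq_of_volterra {D : ℝ → Vec n} (hD : IntervalIntegrable D volume 0 r)
    (hvolterra : ∀ s ∈ Set.uIcc 0 r, D s = g s + c - ∫ u in (0 : ℝ)..s, ρ *ᵥ D u) :
    variationOfConstants ρ c g r = D r := by
  have hparts := mulVec_sub_integral_eq c (hasDerivAt_nu_apply ρ) (continuous_nu_mul ρ)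
    (intervalIntegrable_mulVec continuous_const hD : IntervalIntegrable (ρ *ᵥ D ·) volume 0 r)
  have hintegral : ∫ s in (0 : ℝ)..r, ((nu ρ s * ρ) *ᵥ (c - ∫ u in (0 : ℝ)..s, ρ *ᵥ D u) -
      nu ρ s *ᵥ (ρ *ᵥ D s)) = -∫ s in (0 : ℝ)..r, (nu ρ s * ρ) *ᵥ g s := by
    rw [← intervalIntegral.integral_neg]
    refine intervalIntegral.integral_congr fun s hs => ?_
    rw [Matrix.mulVec_mulVec, ← Matrix.mulVec_sub, ← Matrix.mulVec_neg, hvolterra s hs]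
    congr 1
    abel
  rw [hintegral, nu_zero, Matrix.one_mulVec, ← sub_eq_add_neg] at hparts
  rw [variationOfConstants, ← hparts, inv_nu, Matrix.mulVec_mulVec, nu_neg_mul_nu,
    Matrix.one_mulVec, hvolterra r Set.right_mem_uIcc]
  abel

end VariationOfConstants

/-! ### Stieltjes integrals of constant matrices -/

section Stieltjes

variable {n : ℕ}

theorem isFiniteMeasure_variation {α : Type*} {mα : MeasurableSpace α}
    (μ : VectorMeasure α (Vec n)) : IsFiniteMeasure μ.variation := by
  let coord : Fin n → SignedMeasure α := fun i =>
    μ.mapRange (LinearMap.proj (R := ℝ) (φ := fun _ : Fin n => ℝ) i).toAddMonoidHom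
      (continuous_apply i)
  refine isFiniteMeasure_of_le (∑ i, (coord i).totalVariation)
    (VectorMeasure.variation_le_of_forall_enorm_le fun E _ => ?_)
  have hsup : ‖μ E‖ₑ ≤ ∑ i, ‖μ E i‖ₑ := by
    simp only [enorm_eq_nnnorm]
    rw [← ENNReal.ofNNReal_finsetSum, ENNReal.coe_le_coe]
    exact pi_nnnorm_le_iff.2 fun i =>
      Finset.single_le_sum (f := fun i => ‖μ E i‖₊) (fun _ _ => zero_le) (Finset.mem_univ i)
  rw [Measure.finsetSum_apply]
  exact hsup.trans (Finset.sum_le_sum fun i _ => (coord i).enorm_le_totalVariation E)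

theorem stieltjesIntegral_const_Icc (A : Mat n) {f : ℝ → Vec n} {y : Vec n} {a b : ℝ} (hab : a ≤ b)
    (hf : BoundedVariationOn f Set.univ) (hright : ContinuousWithinAt f (Set.Ici b) b)
    (hleft : Tendsto f (𝓝[<] a) (𝓝 y)) :
    stieltjesIntegral (Set.Icc a b) (fun _ => A) f = A *ᵥ (f b - y) := by
  have := isFiniteMeasure_variation hf.vectorMeasure
  have hmeasure : hf.vectorMeasure (Set.Icc a b) = f b - y := by
    rw [hf.vectorMeasure_Icc hab, leftLim_eq_of_tendsto hleft,
      rightLim_eq_of_tendsto (hright.mono_left (nhdsWithin_mono _ Set.Ioi_subset_Ici_self))]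
  rw [stieltjesIntegral, dif_pos hf, VectorMeasure.integral_const,
    VectorMeasure.restrict_apply _ measurableSet_Icc MeasurableSet.univ, Set.univ_inter, hmeasure]
  simp

end Stieltjes

/-! ### Piecewise defined paths -/

section Piecewise

variable {E : Type*} [NormedAddCommGroup E] {f g : ℝ → E}

theorem boundedVariationOn_const (c : E) (s : Set ℝ) : BoundedVariationOn (fun _ => c) s := by
  rw [BoundedVariationOn, eVariationOn.constant_on]
  · exact ENNReal.zero_ne_top
  · rintro _ ⟨_, _, rfl⟩ _ ⟨_, _, rfl⟩
    rfl

theorem boundedVariationOn_add {s : Set ℝ} (hf : BoundedVariationOn f s)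
    (hg : BoundedVariationOn g s) : BoundedVariationOn (fun t => f t + g t) s := by
  refine ne_top_of_le_ne_top (ENNReal.add_ne_top.2 ⟨hf, hg⟩) (iSup_le fun u => ?_)
  calc ∑ i ∈ Finset.range u.1, edist (f (u.2.1 (i + 1)) + g (u.2.1 (i + 1)))
          (f (u.2.1 i) + g (u.2.1 i))
      ≤ ∑ i ∈ Finset.range u.1, (edist (f (u.2.1 (i + 1))) (f (u.2.1 i)) +
          edist (g (u.2.1 (i + 1))) (g (u.2.1 i))) :=
        Finset.sum_le_sum fun i _ => edist_add_add_le _ _ _ _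
    _ ≤ eVariationOn f s + eVariationOn g s := by
        rw [Finset.sum_add_distrib]
        exact add_le_add (eVariationOn.sum_le u.2.2.1 u.2.2.2)
          (eVariationOn.sum_le u.2.2.1 u.2.2.2)

theorem boundedVariationOn_ite_lt [NormedSpace ℝ E] (t : ℝ) {s : Set ℝ}
    (hf : BoundedVariationOn f s) (hg : BoundedVariationOn g s) :
    BoundedVariationOn (fun u => if u < t then f u else g u) s := by
  have hstep : BoundedVariationOn (fun u : ℝ => if u < t then (0 : ℝ) else 1) s := by
    refine MonotoneOn.boundedVariationOn (C := 1) (fun u _ v _ huv => ?_) fun u _ => ?_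
    · split_ifs <;> linarith
    · split_ifs <;> simp
  have hsplit : (fun u => if u < t then f u else g u) = fun u =>
      (1 + (-1 : ℝ) * if u < t then (0 : ℝ) else 1) • f u +
        (if u < t then (0 : ℝ) else 1) • g u := by
    ext u
    split_ifs <;> simp
  rw [hsplit]
  exact boundedVariationOn_add ((boundedVariationOn_add (boundedVariationOn_const 1 s)
    ((boundedVariationOn_const (-1) s).fun_mul hstep)).fun_smul hf) (hstep.fun_smul hg)

theorem continuousWithinAt_Ici_ite_lt {E : Type*} [TopologicalSpace E] {f g : ℝ → E} {t s : ℝ}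
    (hf : ContinuousWithinAt f (Set.Ici s) s) (hg : ContinuousWithinAt g (Set.Ici s) s) :
    ContinuousWithinAt (fun u => if u < t then f u else g u) (Set.Ici s) s := by
  rcases lt_or_ge s t with hst | hst
  · refine hf.congr_of_eventuallyEq ?_ (if_pos hst)
    filter_upwards [mem_nhdsWithin_of_mem_nhds (Iio_mem_nhds hst)] with u hu
    exact if_pos hu
  · exact hg.congr (fun u hu => if_neg (hst.trans hu).not_gt) (if_neg hst.not_gt)

end Piecewise

/-! ### Deterministic processes with a terminal jump -/

section JumpAtEnd

variable {n : ℕ} {T : ℝ} {Ω : Type*}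

/-- The deterministic process that follows `f` on `[0, T)` and takes the value `q` at time `T`; the
optimal position and its deviation are of this form. -/
noncomputable def jumpAtEnd (Ω : Type*) {T : ℝ} (f : ℝ → Vec n) (q : Vec n) (s : Time T)
    (_ : Ω) : Vec n :=
  if (s : ℝ) < T then f s else q

theorem path_coe (hT : 0 < T) (X : Time T → Ω → Vec n) (ω : Ω) (r : Time T) :
    path hT X ω r = X r ω :=
  Set.IccExtend_val hT.le _ r

theorem path_of_mem (hT : 0 < T) (X : Time T → Ω → Vec n) (ω : Ω) {s : ℝ}
    (hs : s ∈ Set.Icc 0 T) : path hT X ω s = X ⟨s, hs⟩ ω :=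
  Set.IccExtend_of_mem hT.le _ hs

theorem path_jumpAtEnd_of_mem_Ico (hT : 0 < T) (f : ℝ → Vec n) (q : Vec n) (ω : Ω) {s : ℝ}
    (hs : s ∈ Set.Ico 0 T) : path hT (jumpAtEnd Ω f q) ω s = f s := by
  rw [path_of_mem hT _ ω (Set.Ico_subset_Icc_self hs), jumpAtEnd, if_pos hs.2]

theorem path_jumpAtEnd_ae_eq (hT : 0 < T) (f : ℝ → Vec n) (q : Vec n) (ω : Ω) :
    path hT (jumpAtEnd Ω f q) ω =ᵐ[volume.restrict (Set.Icc 0 T)] f := by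
  rw [restrict_Ico_eq_restrict_Icc.symm]
  filter_upwards [ae_restrict_mem measurableSet_Ico] with s hs
  exact path_jumpAtEnd_of_mem_Ico hT f q ω hs

theorem intervalIntegrable_path_jumpAtEnd (hT : 0 < T) {f : ℝ → Vec n}
    (hf : ContinuousOn f (Set.Icc 0 T)) (q : Vec n) (ω : Ω) :
    IntervalIntegrable (path hT (jumpAtEnd Ω f q) ω) volume 0 T := by
  rw [intervalIntegrable_iff_integrableOn_Icc_of_le hT.le]
  exact hf.integrableOn_Icc.congr (path_jumpAtEnd_ae_eq hT f q ω).symm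

theorem intervalIntegral_path_jumpAtEnd {E : Type*} [NormedAddCommGroup E] [NormedSpace ℝ E]
    (hT : 0 < T) (f : ℝ → Vec n) (q : Vec n) (ω : Ω) (F : Vec n → E) (r : Time T) :
    ∫ s in (0 : ℝ)..r, F (path hT (jumpAtEnd Ω f q) ω s) = ∫ s in (0 : ℝ)..r, F (f s) := by
  rw [intervalIntegral_eq_integral_Icc r.2.1, intervalIntegral_eq_integral_Icc r.2.1]
  refine integral_congr_ae ?_
  filter_upwards [ae_restrict_of_ae_restrict_of_subset (Set.Icc_subset_Icc_right r.2.2)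
    (path_jumpAtEnd_ae_eq hT f q ω)] with s hs
  rw [hs]

theorem lintegral_dotProduct_self_path_jumpAtEnd_lt_top (hT : 0 < T) {f : ℝ → Vec n}
    (hf : ContinuousOn f (Set.Icc 0 T)) (q : Vec n) (A : Mat n) (ω : Ω) :
    ∫⁻ s in Set.Icc 0 T, ENNReal.ofReal ((A *ᵥ path hT (jumpAtEnd Ω f q) ω s) ⬝ᵥ
      (A *ᵥ path hT (jumpAtEnd Ω f q) ω s)) < ∞ := by
  have hcont : ContinuousOn (fun s => (A *ᵥ f s) ⬝ᵥ (A *ᵥ f s)) (Set.Icc 0 T) := by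
    have hAf : ContinuousOn (fun s => A *ᵥ f s) (Set.Icc 0 T) :=
      (continuous_const.matrix_mulVec continuous_id).comp_continuousOn hf
    exact (continuous_id.dotProduct continuous_id).comp_continuousOn hAf
  refine lt_of_eq_of_lt (lintegral_congr_ae ?_) hcont.integrableOn_Icc.lintegral_lt_top
  filter_upwards [path_jumpAtEnd_ae_eq hT f q ω] with s hs
  rw [hs]

theorem tendsto_pathFrom_zero_left (hT : 0 < T) (x : Vec n) (X : Time T → Ω → Vec n) (ω : Ω) :
    Tendsto (pathFrom hT x X ω) (𝓝[<] 0) (𝓝 x) := by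
  refine tendsto_const_nhds.congr' ?_
  filter_upwards [self_mem_nhdsWithin] with s hs
  exact (if_pos hs).symm

theorem pathFrom_jumpAtEnd (hT : 0 < T) (x : Vec n) (f : ℝ → Vec n) (q : Vec n) (ω : Ω) :
    pathFrom hT x (jumpAtEnd Ω f q) ω = fun s =>
      if s < 0 then x else if s < T then f (Set.projIcc 0 T hT.le s) else q := by
  ext1 s
  rw [pathFrom]
  split_ifs with h0 h1
  · rfl
  · have hs : s ∈ Set.Ico 0 T := ⟨not_lt.1 h0, h1⟩
    rw [path_jumpAtEnd_of_mem_Ico hT f q ω hs,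
      Set.projIcc_of_mem hT.le (Set.Ico_subset_Icc_self hs)]
  · rw [path, Set.IccExtend_of_right_le hT.le _ (not_lt.1 h1), jumpAtEnd, if_neg (lt_irrefl T)]

variable {mΩ : MeasurableSpace Ω}

theorem isCadlagFV_jumpAtEnd (hT : 0 < T) (𝓕 : Filtration (Time T) mΩ) (x : Vec n)
    {f : ℝ → Vec n} (hf : ContinuousOn f (Set.Icc 0 T)) (hf' : BoundedVariationOn f (Set.Icc 0 T))
    (q : Vec n) : IsCadlagFV hT 𝓕 x (jumpAtEnd Ω f q) where
  adapted _ := measurable_const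
  right_continuous ω s := by
    have hcont : Continuous fun u => f (Set.projIcc 0 T hT.le u) :=
      hf.comp_continuous (continuous_subtype_val.comp continuous_projIcc) fun u =>
        (Set.projIcc 0 T hT.le u).2
    rw [pathFrom_jumpAtEnd]
    exact continuousWithinAt_Ici_ite_lt continuousWithinAt_const
      (continuousWithinAt_Ici_ite_lt hcont.continuousWithinAt continuousWithinAt_const)
  finite_variation ω := by
    have hproj : BoundedVariationOn (fun u => f (Set.projIcc 0 T hT.le u)) Set.univ :=
      ne_top_of_le_ne_top hf' (eVariationOn.comp_le_of_monotoneOn f _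
        (fun _ _ _ _ h => Set.monotone_projIcc hT.le h) fun u _ => (Set.projIcc 0 T hT.le u).2)
    rw [pathFrom_jumpAtEnd]
    exact boundedVariationOn_ite_lt 0 (boundedVariationOn_const x _)
      (boundedVariationOn_ite_lt T hproj (boundedVariationOn_const q _))

theorem isStronglyProgressive_jumpAtEnd (𝓕 : Filtration (Time T) mΩ) {f : ℝ → Vec n}
    (hf : Measurable f) (q : Vec n) : IsStronglyProgressive 𝓕 (jumpAtEnd Ω f q) := by
  intro t
  have hpath : Measurable fun s : ℝ => if s < T then f s else q :=
    Measurable.ite measurableSet_Iio hf measurable_const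
  exact ((hpath.comp (measurable_subtype_coe.comp measurable_subtype_coe)).comp
    (@measurable_fst _ _ _ (𝓕 t))).stronglyMeasurable

theorem squareIntegrableDeviation_jumpAtEnd (P : Measure Ω) [IsFiniteMeasure P] (hT : 0 < T)
    (O : Mat n) (lam : Vec n) {f : ℝ → Vec n} (hf : ContinuousOn f (Set.Icc 0 T)) (q : Vec n) :
    SquareIntegrableDeviation P hT O lam (jumpAtEnd Ω f q) := by
  rcases isEmpty_or_nonempty Ω with _ | ⟨⟨ω⟩⟩
  · simp [SquareIntegrableDeviation]
  · have hconst := lintegral_const (μ := P) (∫⁻ s in Set.Icc 0 T, ENNReal.ofReal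
      ((impactPow O lam (-(1 / 2)) *ᵥ path hT (jumpAtEnd Ω f q) ω s) ⬝ᵥ
        (impactPow O lam (-(1 / 2)) *ᵥ path hT (jumpAtEnd Ω f q) ω s)))
    exact lt_of_eq_of_lt hconst (ENNReal.mul_lt_top
      (lintegral_dotProduct_self_path_jumpAtEnd_lt_top hT hf q _ ω) (measure_lt_top P _))

end JumpAtEnd

/-! ### The deviation process -/

section Deviation

variable {n : ℕ} {O : Mat n} {lam : Vec n} {ρ : Mat n} {T : ℝ} {Ω : Type*} (hT : 0 < T)
  {x d : Vec n} {X : Time T → Ω → Vec n} {ω : Ω}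

theorem deviation_eq_variationOfConstants (r : Time T) :
    deviation hT O lam ρ x d X r ω = variationOfConstants ρ (d - impact O lam *ᵥ x)
      (fun s => impact O lam *ᵥ path hT X ω s) r := by
  simp only [deviation, variationOfConstants, path_coe, Matrix.mulVec_mulVec]

theorem path_deviation {s : ℝ} (hs : s ∈ Set.Icc 0 T) :
    path hT (deviation hT O lam ρ x d X) ω s = variationOfConstants ρ (d - impact O lam *ᵥ x)
      (fun s => impact O lam *ᵥ path hT X ω s) s := by
  rw [path_of_mem hT _ ω hs, deviation_eq_variationOfConstants]

theorem uIcc_zero_subset (r : Time T) : Set.uIcc 0 (r : ℝ) ⊆ Set.Icc 0 T := by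
  rw [Set.uIcc_of_le r.2.1]
  exact Set.Icc_subset_Icc_right r.2.2

theorem intervalIntegrable_zero_coe {E : Type*} [NormedAddCommGroup E] {f : ℝ → E}
    (hf : IntervalIntegrable f volume 0 T) (r : Time T) : IntervalIntegrable f volume 0 r :=
  hf.mono_set ((uIcc_zero_subset r).trans Set.Icc_subset_uIcc)

theorem deviation_eq_sub_integral (hX : IntervalIntegrable (path hT X ω) volume 0 T)
    (r : Time T) :
    deviation hT O lam ρ x d X r ω = impact O lam *ᵥ X r ω + (d - impact O lam *ᵥ x) -
      ∫ s in (0 : ℝ)..r, ρ *ᵥ path hT (deviation hT O lam ρ x d X) ω s := by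
  have hγX : IntervalIntegrable (fun s => impact O lam *ᵥ path hT X ω s) volume 0 r :=
    intervalIntegrable_mulVec continuous_const (intervalIntegrable_zero_coe hX r)
  rw [deviation_eq_variationOfConstants, variationOfConstants_eq_sub_integral _ _ hγX, path_coe]
  congr 1
  refine intervalIntegral.integral_congr fun s hs => ?_
  simp only [path_deviation hT (uIcc_zero_subset r hs)]

theorem deviation_eq_of_volterra {D : Time T → Ω → Vec n}
    (hD : IntervalIntegrable (path hT D ω) volume 0 T)
    (hvolterra : ∀ r : Time T, D r ω = impact O lam *ᵥ X r ω + (d - impact O lam *ᵥ x) -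
      ∫ s in (0 : ℝ)..r, ρ *ᵥ path hT D ω s) (r : Time T) :
    deviation hT O lam ρ x d X r ω = D r ω := by
  rw [deviation_eq_variationOfConstants, ← path_coe hT D]
  refine variationOfConstants_eq_of_volterra _ _ (intervalIntegrable_zero_coe hD r) fun s hs => ?_
  have hs' : s ∈ Set.Icc 0 T := uIcc_zero_subset r hs
  rw [path_of_mem hT D ω hs', hvolterra ⟨s, hs'⟩, path_of_mem hT X ω hs']

theorem isDeviationFV_deviation {mΩ : MeasurableSpace Ω} {𝓕 : Filtration (Time T) mΩ}
    (hX : IsCadlagFV hT 𝓕 x X) (hD : IsCadlagFV hT 𝓕 d (deviation hT O lam ρ x d X))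
    (hint : ∀ ω, IntervalIntegrable (path hT X ω) volume 0 T) :
    IsDeviationFV hT 𝓕 O lam ρ x d X (deviation hT O lam ρ x d X) := by
  refine ⟨hD, fun ω r => ?_⟩
  rw [stieltjesIntegral_const_Icc _ r.2.1 (hX.finite_variation ω) (hX.right_continuous ω r)
    (tendsto_pathFrom_zero_left hT x X ω), pathFrom, if_neg r.2.1.not_gt, path_coe,
    Matrix.mulVec_sub, deviation_eq_sub_integral hT (hint ω) r]
  abel

end Deviation

/-! ### The optimal strategy -/

section Candidate

variable {n : ℕ} {T : ℝ} {O : Mat n} {lam : Vec n} {ρ : Mat n}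

/-- The position `X*(T-)` just before the optimal strategy closes it at time `T`. -/
noncomputable def preTerminalPosition (T : ℝ) (O : Mat n) (lam : Vec n) (ρ : Mat n)
    (x d : Vec n) : Vec n :=
  ((2 : ℝ) • (1 : Mat n) + T • ρ)⁻¹ *ᵥ (x - impactPow O lam (-1) *ᵥ d)

/-- The constant value on `[0, T)` of the deviation of the optimal strategy. -/
noncomputable def steadyDeviation (T : ℝ) (O : Mat n) (lam : Vec n) (ρ : Mat n)
    (x d : Vec n) : Vec n :=
  ((2 : ℝ) • (1 : Mat n) + T • ρ)⁻¹ *ᵥ (d - impact O lam *ᵥ x)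

/-- The optimal strategy `X*`, with the closing trade at time `T`. -/
noncomputable def optimalStrategy (Ω : Type*) (T : ℝ) (O : Mat n) (lam : Vec n) (ρ : Mat n)
    (x d : Vec n) : Time T → Ω → Vec n :=
  jumpAtEnd Ω (fun s => (1 + (T - s) • ρ) *ᵥ preTerminalPosition T O lam ρ x d) 0

theorem two_smul_steadyDeviation_add (hρ : ρ.PosSemidef) (hT : 0 ≤ T) (O : Mat n)
    (lam x d : Vec n) :
    (2 : ℝ) • steadyDeviation T O lam ρ x d + T • ρ *ᵥ steadyDeviation T O lam ρ x d =
      d - impact O lam *ᵥ x := by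
  have hfactor (q : Vec n) : (2 : ℝ) • q + T • ρ *ᵥ q = ((2 : ℝ) • (1 : Mat n) + T • ρ) *ᵥ q := by
    simp only [Matrix.add_mulVec, Matrix.smul_mulVec, Matrix.one_mulVec]
  rw [hfactor, steadyDeviation, Matrix.mulVec_mulVec,
    Matrix.mul_nonsing_inv _ (isUnit_det_smul_one_add_smul hρ two_pos hT), Matrix.one_mulVec]

theorem two_smul_impactPow_mulVec_steadyDeviation_add
    (hO : O ∈ Matrix.orthogonalGroup (Fin n) ℝ) (hcomm : Commute ρ (impact O lam))
    (hρ : ρ.PosSemidef) (hT : 0 ≤ T) (x d : Vec n) :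
    (2 : ℝ) • impactPow O lam (-(1 / 2)) *ᵥ steadyDeviation T O lam ρ x d +
      (volume.restrict (Set.Icc 0 T)).real Set.univ •
        ρ *ᵥ (impactPow O lam (-(1 / 2)) *ᵥ steadyDeviation T O lam ρ x d) =
      impactPow O lam (-(1 / 2)) *ᵥ (d - impact O lam *ᵥ x) := by
  have hvolume : (volume.restrict (Set.Icc 0 T)).real Set.univ = T := by
    rw [measureReal_restrict_apply_univ, Real.volume_real_Icc_of_le hT, sub_zero]
  rw [hvolume, ← two_smul_steadyDeviation_add hρ hT O lam x d, Matrix.mulVec_add,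
    Matrix.mulVec_smul, Matrix.mulVec_smul, Matrix.mulVec_mulVec, Matrix.mulVec_mulVec,
    (commute_impactPow hO hcomm _).eq]

theorem commute_impactPow_inv_smul_one_add_smul (hO : O ∈ Matrix.orthogonalGroup (Fin n) ℝ)
    (hcomm : Commute ρ (impact O lam)) (a t α : ℝ) :
    Commute (impactPow O lam α) (a • (1 : Mat n) + t • ρ)⁻¹ :=
  commute_nonsing_inv (((Commute.one_right _).smul_right a).add_right
    ((commute_impactPow hO hcomm α).symm.smul_right t))

theorem impact_mulVec_preTerminalPosition (hO : O ∈ Matrix.orthogonalGroup (Fin n) ℝ)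
    (hlam : ∀ j, 0 < lam j) (hcomm : Commute ρ (impact O lam)) (T : ℝ) (x d : Vec n) :
    impact O lam *ᵥ preTerminalPosition T O lam ρ x d = -steadyDeviation T O lam ρ x d := by
  rw [preTerminalPosition, steadyDeviation, ← impactPow_one, Matrix.mulVec_mulVec,
    (commute_impactPow_inv_smul_one_add_smul hO hcomm 2 T 1).eq, ← Matrix.mulVec_mulVec,
    Matrix.mulVec_sub, impactPow_mulVec_impactPow_mulVec hO hlam, add_neg_cancel,
    impactPow_zero hO, Matrix.one_mulVec, ← Matrix.mulVec_neg, neg_sub]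

theorem steadyDeviation_eq (hO : O ∈ Matrix.orthogonalGroup (Fin n) ℝ)
    (hlam : ∀ j, 0 < lam j) (hcomm : Commute ρ (impact O lam)) (T : ℝ) (x d : Vec n) :
    steadyDeviation T O lam ρ x d =
      impactPow O lam (1 / 2) *ᵥ (((2 : ℝ) • (1 : Mat n) + T • ρ)⁻¹ *ᵥ
        (impactPow O lam (-(1 / 2)) *ᵥ d - impactPow O lam (1 / 2) *ᵥ x)) := by
  rw [Matrix.mulVec_mulVec, (commute_impactPow_inv_smul_one_add_smul hO hcomm 2 T (1 / 2)).eq,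
    ← Matrix.mulVec_mulVec, Matrix.mulVec_sub, impactPow_mulVec_impactPow_mulVec hO hlam,
    impactPow_mulVec_impactPow_mulVec hO hlam, add_neg_cancel, add_halves, impactPow_zero hO,
    Matrix.one_mulVec, impactPow_one, steadyDeviation]

variable {Ω : Type*} (hT : 0 < T)

theorem intervalIntegrable_path_optimalStrategy (x d : Vec n) (ω : Ω) :
    IntervalIntegrable (path hT (optimalStrategy Ω T O lam ρ x d) ω) volume 0 T :=
  intervalIntegrable_path_jumpAtEnd hT (by fun_prop) 0 ω

theorem deviation_optimalStrategy (hO : O ∈ Matrix.orthogonalGroup (Fin n) ℝ)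
    (hlam : ∀ j, 0 < lam j) (hρ : ρ.PosSemidef) (hcomm : Commute ρ (impact O lam))
    (x d : Vec n) :
    deviation hT O lam ρ x d (optimalStrategy Ω T O lam ρ x d) =
      jumpAtEnd Ω (fun _ => steadyDeviation T O lam ρ x d)
        ((2 : ℝ) • steadyDeviation T O lam ρ x d) := by
  set q := steadyDeviation T O lam ρ x d with hq
  have hinit : d - impact O lam *ᵥ x = (2 : ℝ) • q + T • ρ *ᵥ q :=
    (two_smul_steadyDeviation_add hρ hT.le O lam x d).symm
  have hposition : ∀ s : ℝ, impact O lam *ᵥ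
      ((1 + (T - s) • ρ) *ᵥ preTerminalPosition T O lam ρ x d) = -q - (T - s) • ρ *ᵥ q := by
    intro s
    have hcomm' : Commute (impact O lam) (1 + (T - s) • ρ) :=
      (Commute.one_right _).add_right (hcomm.symm.smul_right _)
    rw [Matrix.mulVec_mulVec, hcomm'.eq, ← Matrix.mulVec_mulVec,
      impact_mulVec_preTerminalPosition hO hlam hcomm, ← hq, Matrix.add_mulVec, Matrix.one_mulVec,
      Matrix.smul_mulVec, Matrix.mulVec_neg, smul_neg, ← sub_eq_add_neg]
  ext1 r
  ext1 ω
  refine deviation_eq_of_volterra hT (intervalIntegrable_path_jumpAtEnd hT continuousOn_const _ ω)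
    (fun r => ?_) r
  rw [intervalIntegral_path_jumpAtEnd hT _ _ ω (ρ *ᵥ ·) r, intervalIntegral.integral_const,
    sub_zero, hinit, optimalStrategy, jumpAtEnd, jumpAtEnd]
  split_ifs with hr
  · rw [hposition]
    module
  · rw [Matrix.mulVec_zero, le_antisymm r.2.2 (not_lt.1 hr)]
    module

theorem isCadlagFV_optimalStrategy {mΩ : MeasurableSpace Ω} (𝓕 : Filtration (Time T) mΩ)
    (x d : Vec n) : IsCadlagFV hT 𝓕 x (optimalStrategy Ω T O lam ρ x d) := by
  have hsmooth : ContDiff ℝ 1 fun s : ℝ =>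
      (1 + (T - s) • ρ) *ᵥ preTerminalPosition T O lam ρ x d := by
    simp only [Matrix.add_mulVec, Matrix.smul_mulVec]
    fun_prop
  have hbv := hsmooth.contDiffOn (s := Set.uIcc 0 T)
    |>.absolutelyContinuousOnInterval.boundedVariationOn
  rw [Set.uIcc_of_le hT.le] at hbv
  exact isCadlagFV_jumpAtEnd hT 𝓕 x hsmooth.continuous.continuousOn hbv 0

theorem optimalStrategy_endTime (x d : Vec n) (ω : Ω) :
    optimalStrategy Ω T O lam ρ x d (endTime hT) ω = 0 :=
  if_neg (lt_irrefl T)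

theorem isDeviationFV_optimalStrategy (hO : O ∈ Matrix.orthogonalGroup (Fin n) ℝ)
    (hlam : ∀ j, 0 < lam j) (hρ : ρ.PosSemidef) (hcomm : Commute ρ (impact O lam))
    {mΩ : MeasurableSpace Ω} (𝓕 : Filtration (Time T) mΩ) (x d : Vec n) :
    IsDeviationFV hT 𝓕 O lam ρ x d (optimalStrategy Ω T O lam ρ x d)
      (deviation hT O lam ρ x d (optimalStrategy Ω T O lam ρ x d)) := by
  refine isDeviationFV_deviation hT (isCadlagFV_optimalStrategy hT 𝓕 x d) ?_
    (intervalIntegrable_path_optimalStrategy hT x d)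
  rw [deviation_optimalStrategy hT hO hlam hρ hcomm]
  exact isCadlagFV_jumpAtEnd hT 𝓕 d continuousOn_const (boundedVariationOn_const _ _) _

variable {mΩ : MeasurableSpace Ω} (P : Measure Ω) [IsFiniteMeasure P]

theorem squareIntegrableDeviation_optimalStrategy (hO : O ∈ Matrix.orthogonalGroup (Fin n) ℝ)
    (hlam : ∀ j, 0 < lam j) (hρ : ρ.PosSemidef) (hcomm : Commute ρ (impact O lam))
    (x d : Vec n) :
    SquareIntegrableDeviation P hT O lam
      (deviation hT O lam ρ x d (optimalStrategy Ω T O lam ρ x d)) := by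
  rw [deviation_optimalStrategy hT hO hlam hρ hcomm]
  exact squareIntegrableDeviation_jumpAtEnd P hT O lam continuousOn_const _

theorem isPMStrategy_optimalStrategy (hO : O ∈ Matrix.orthogonalGroup (Fin n) ℝ)
    (hlam : ∀ j, 0 < lam j) (hρ : ρ.PosSemidef) (hcomm : Commute ρ (impact O lam))
    (𝓕 : Filtration (Time T) mΩ) (x d : Vec n) :
    IsPMStrategy P hT 𝓕 O lam ρ x d (optimalStrategy Ω T O lam ρ x d) where
  progressive := isStronglyProgressive_jumpAtEnd 𝓕 (Continuous.measurable (by fun_prop)) 0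
  square_integrable := ae_of_all P fun ω => by
    simpa only [optimalStrategy, Matrix.one_mulVec] using
      lintegral_dotProduct_self_path_jumpAtEnd_lt_top (Ω := Ω) hT (by fun_prop) 0 1 ω
  terminal := ae_of_all P (optimalStrategy_endTime hT x d)
  deviation_integrable := squareIntegrableDeviation_optimalStrategy hT P hO hlam hρ hcomm x d

theorem isFVStrategy_optimalStrategy (hO : O ∈ Matrix.orthogonalGroup (Fin n) ℝ)
    (hlam : ∀ j, 0 < lam j) (hρ : ρ.PosSemidef) (hcomm : Commute ρ (impact O lam))
    (𝓕 : Filtration (Time T) mΩ) (x d : Vec n) :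
    IsFVStrategy P hT 𝓕 O lam ρ x d (optimalStrategy Ω T O lam ρ x d) where
  cadlagFV := isCadlagFV_optimalStrategy hT 𝓕 x d
  terminal := optimalStrategy_endTime hT x d
  deviation_integrable := ⟨_, isDeviationFV_optimalStrategy hT hO hlam hρ hcomm 𝓕 x d,
    squareIntegrableDeviation_optimalStrategy hT P hO hlam hρ hcomm x d⟩

end Candidate

/-! ### Joint measurability -/

section Measurability

theorem stronglyMeasurable_intervalIntegral {α E : Type*} {mα : MeasurableSpace α}
    [NormedAddCommGroup E] [NormedSpace ℝ E] {f : α × ℝ → E} (hf : StronglyMeasurable f)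
    {a b : α → ℝ} (ha : Measurable a) (hb : Measurable b) :
    StronglyMeasurable fun x => ∫ s in a x..b x, f (x, s) := by
  have hIoc {u v : α → ℝ} (hu : Measurable u) (hv : Measurable v) :
      StronglyMeasurable fun x => ∫ s in Set.Ioc (u x) (v x), f (x, s) := by
    have hset : MeasurableSet {p : α × ℝ | p.2 ∈ Set.Ioc (u p.1) (v p.1)} :=
      (measurableSet_lt (hu.comp measurable_fst) measurable_snd).inter
        (measurableSet_le measurable_snd (hv.comp measurable_fst))
    convert (hf.indicator hset).integral_prod_right' (ν := volume) using 2 with x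
    rw [← integral_indicator measurableSet_Ioc]
    rfl
  exact (hIoc ha hb).sub (hIoc hb ha)

variable {n : ℕ}

theorem measurable_mulVec_comp {α S : Type*} {mα : MeasurableSpace α} [TopologicalSpace S]
    [MeasurableSpace S] [OpensMeasurableSpace S] {A : S → Mat n} (hA : Continuous A) {s : α → S}
    (hs : Measurable s) {f : α → Vec n} (hf : Measurable f) :
    Measurable fun a => A (s a) *ᵥ f a :=
  (Continuous.measurable (f := fun p : S × Vec n => A p.1 *ᵥ p.2) (by fun_prop)).comp
    (hs.prodMk hf)

theorem measurable_variationOfConstants {α : Type*} {mα : MeasurableSpace α} (ρ : Mat n)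
    (c : Vec n) {g : α × ℝ → Vec n} (hg : Measurable g) {r : α → ℝ} (hr : Measurable r) :
    Measurable fun a => variationOfConstants ρ c (fun s => g (a, s)) (r a) := by
  have hint : Measurable fun a => ∫ s in (0 : ℝ)..r a, (nu ρ s * ρ) *ᵥ g (a, s) :=
    (stronglyMeasurable_intervalIntegral
      (measurable_mulVec_comp (continuous_nu_mul ρ) measurable_snd hg).stronglyMeasurable
      measurable_const hr).measurable
  simp only [variationOfConstants, inv_nu]
  exact (hg.comp (measurable_id.prodMk hr)).add (measurable_mulVec_comp (continuous_nu ρ) hr.neg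
    (measurable_const.sub hint))

variable {T : ℝ} {Ω : Type*} {mΩ : MeasurableSpace Ω} {𝓕 : Filtration (Time T) mΩ} (hT : 0 < T)
  {X : Time T → Ω → Vec n}

theorem measurable_path (hX : IsStronglyProgressive 𝓕 X) :
    Measurable fun p : Ω × ℝ => path hT X p.1 p.2 := by
  have hprog : Measurable fun p : Set.Iic (endTime hT) × Ω => X p.1 p.2 :=
    (hX (endTime hT)).measurable.mono (sup_le_sup le_rfl (MeasurableSpace.comap_mono (𝓕.le _)))
      le_rfl
  have hproj : Measurable fun p : Ω × ℝ => Set.projIcc 0 T hT.le p.2 :=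
    continuous_projIcc.measurable.comp measurable_snd
  exact hprog.comp ((hproj.subtype_mk (h := fun p => (Set.projIcc 0 T hT.le p.2).2.2)).prodMk
    measurable_fst)

theorem measurable_path_deviation (hX : IsStronglyProgressive 𝓕 X) (O : Mat n) (lam : Vec n)
    (ρ : Mat n) (x d : Vec n) :
    Measurable fun p : Ω × ℝ => path hT (deviation hT O lam ρ x d X) p.1 p.2 := by
  simp only [path, Set.IccExtend, Function.comp_apply, deviation_eq_variationOfConstants]
  refine measurable_variationOfConstants ρ _
    (g := fun q : (Ω × ℝ) × ℝ => impact O lam *ᵥ path hT X q.1.1 q.2)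
    (measurable_mulVec_comp continuous_const measurable_snd ?_)
    (measurable_subtype_coe.comp (continuous_projIcc.measurable.comp measurable_snd))
  exact (measurable_path hT hX).comp ((measurable_fst.comp measurable_fst).prodMk measurable_snd)

end Measurability

/-! ### A quadratic functional minimised by constant paths -/

section PathCost

variable {ι α : Type*} [Fintype ι] {mα : MeasurableSpace α} {μ : Measure α}
  {ρ : Matrix ι ι ℝ} {b c : ι → ℝ} {z : α → ι → ℝ}

/-- The cost of a scaled deviation path `z = γ^{-1/2} D` that is closed at the terminal time, up
to the constant `½ dᵀ γ⁻¹ d`: the terminal condition `X(T) = 0` forces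
`γ^{-1/2} D(T) = b - ρ ∫ z`, where `b = γ^{-1/2} (d - γ x)`. -/
noncomputable def pathCost (μ : Measure α) (ρ : Matrix ι ι ℝ) (b : ι → ℝ) (z : α → ι → ℝ) : ℝ :=
  (1 / 2) * ((b - ρ *ᵥ ∫ a, z a ∂μ) ⬝ᵥ (b - ρ *ᵥ ∫ a, z a ∂μ)) + ∫ a, z a ⬝ᵥ (ρ *ᵥ z a) ∂μ

theorem integral_const_dotProduct (v : ι → ℝ) (hz : Integrable z μ) :
    ∫ a, v ⬝ᵥ z a ∂μ = v ⬝ᵥ ∫ a, z a ∂μ := by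
  simp only [dotProduct]
  rw [integral_finsetSum _ fun i _ => (hz.eval i).const_mul _]
  simp only [integral_const_mul, eval_integral fun i => hz.eval i]

theorem pathCost_congr_ae {z' : α → ι → ℝ} (h : z =ᵐ[μ] z') :
    pathCost μ ρ b z = pathCost μ ρ b z' := by
  rw [pathCost, pathCost, integral_congr_ae h,
    integral_congr_ae (h.mono fun a ha => congrArg (fun v => v ⬝ᵥ (ρ *ᵥ v)) ha)]

theorem pathCost_zero_left_nonneg (hρ : ρ.PosSemidef) (z : α → ι → ℝ) : 0 ≤ pathCost μ ρ 0 z :=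
  add_nonneg (mul_nonneg one_half_pos.le (dotProduct_star_self_nonneg _))
    (integral_nonneg fun a => hρ.dotProduct_mulVec_nonneg (z a))

theorem ae_eq_zero_of_pathCost_zero_left_eq_zero (hρ : ρ.PosDef) (hz : MemLp z 2 μ)
    (h : pathCost μ ρ 0 z = 0) : z =ᵐ[μ] 0 := by
  have hquad (a : α) : 0 ≤ z a ⬝ᵥ (ρ *ᵥ z a) := hρ.posSemidef.dotProduct_mulVec_nonneg (z a)
  have hterminal := mul_nonneg one_half_pos.le (dotProduct_star_self_nonneg (0 - ρ *ᵥ ∫ a, z a ∂μ))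
  have hrunning : ∫ a, z a ⬝ᵥ (ρ *ᵥ z a) ∂μ = 0 :=
    ((add_eq_zero_iff_of_nonneg hterminal (integral_nonneg hquad)).1 h).2
  filter_upwards [(integral_eq_zero_iff_of_nonneg hquad
    (integrable_dotProduct hz (memLp_mulVec hz ρ))).1 hrunning] with a ha
  exact eq_zero_of_dotProduct_mulVec_eq_zero hρ ha

variable [IsFiniteMeasure μ]

theorem integral_const_add_dotProduct_mulVec (hρ : ρ.IsSymm) (c : ι → ℝ) (hz : MemLp z 2 μ) :
    ∫ a, (c + z a) ⬝ᵥ (ρ *ᵥ (c + z a)) ∂μ = μ.real Set.univ * (c ⬝ᵥ (ρ *ᵥ c)) +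
      2 * (c ⬝ᵥ (ρ *ᵥ ∫ a, z a ∂μ)) + ∫ a, z a ⬝ᵥ (ρ *ᵥ z a) ∂μ := by
  have hz1 : Integrable z μ := hz.integrable one_le_two
  have hquad : Integrable (fun a => z a ⬝ᵥ (ρ *ᵥ z a)) μ :=
    integrable_dotProduct hz (memLp_mulVec hz ρ)
  have hcross : Integrable (fun a => 2 * ((ρ *ᵥ c) ⬝ᵥ z a)) μ :=
    (integrable_dotProduct (memLp_const (ρ *ᵥ c)) hz).const_mul 2
  have hexpand (a : α) : (c + z a) ⬝ᵥ (ρ *ᵥ (c + z a)) =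
      c ⬝ᵥ (ρ *ᵥ c) + 2 * ((ρ *ᵥ c) ⬝ᵥ z a) + z a ⬝ᵥ (ρ *ᵥ z a) := by
    rw [Matrix.mulVec_add, add_dotProduct, dotProduct_add, dotProduct_add,
      dotProduct_mulVec_comm hρ c (z a), dotProduct_comm (ρ *ᵥ c)]
    ring
  simp only [hexpand]
  have hconst : Integrable (fun _ : α => c ⬝ᵥ (ρ *ᵥ c)) μ := integrable_const _
  have hlower : Integrable (fun a => c ⬝ᵥ (ρ *ᵥ c) + 2 * ((ρ *ᵥ c) ⬝ᵥ z a)) μ := hconst.add hcross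
  rw [integral_add hlower hquad, integral_add hconst hcross, integral_const, smul_eq_mul,
    integral_const_mul, integral_const_dotProduct _ hz1,
    dotProduct_mulVec_comm hρ c (∫ a, z a ∂μ), dotProduct_comm (ρ *ᵥ c) (∫ a, z a ∂μ)]

/-- Completing the square: the hypothesis on `c` says that `c` is stationary for the cost among
constant paths, and then the first-order term vanishes in all directions `z`. -/
theorem pathCost_const_add (hρ : ρ.IsSymm) (hc : (2 : ℝ) • c + μ.real Set.univ • ρ *ᵥ c = b)
    (hz : MemLp z 2 μ) :
    pathCost μ ρ b (fun a => c + z a) = pathCost μ ρ b (fun _ => c) + pathCost μ ρ 0 z := by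
  have hmean : ∫ a, c + z a ∂μ = μ.real Set.univ • c + ∫ a, z a ∂μ := by
    rw [integral_add (integrable_const c) (hz.integrable one_le_two), integral_const]
  have hterminal_const : b - ρ *ᵥ (μ.real Set.univ • c) = (2 : ℝ) • c := by
    rw [← hc, Matrix.mulVec_smul, add_sub_cancel_right]
  simp only [pathCost]
  rw [hmean, integral_const_add_dotProduct_mulVec hρ c hz, integral_const, integral_const,
    Matrix.mulVec_add, ← sub_sub, hterminal_const]
  simp only [sub_dotProduct, dotProduct_sub, smul_dotProduct, dotProduct_smul, zero_dotProduct,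
    dotProduct_zero, smul_eq_mul, dotProduct_comm (ρ *ᵥ ∫ a, z a ∂μ) c]
  ring

theorem pathCost_eq_const_add (hρ : ρ.IsSymm) (hc : (2 : ℝ) • c + μ.real Set.univ • ρ *ᵥ c = b)
    (hz : MemLp z 2 μ) :
    pathCost μ ρ b z = pathCost μ ρ b (fun _ => c) + pathCost μ ρ 0 (fun a => z a - c) := by
  simpa only [add_sub_cancel] using
    pathCost_const_add hρ hc (z := fun a => z a - c) (hz.sub (memLp_const c))

theorem pathCost_const_le (hρ : ρ.PosSemidef)
    (hc : (2 : ℝ) • c + μ.real Set.univ • ρ *ᵥ c = b) (hz : MemLp z 2 μ) :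
    pathCost μ ρ b (fun _ => c) ≤ pathCost μ ρ b z := by
  rw [pathCost_eq_const_add (Matrix.isHermitian_iff_isSymm.1 hρ.isHermitian) hc hz]
  exact le_add_of_nonneg_right (pathCost_zero_left_nonneg hρ _)

theorem ae_eq_const_of_pathCost_eq (hρ : ρ.PosDef)
    (hc : (2 : ℝ) • c + μ.real Set.univ • ρ *ᵥ c = b) (hz : MemLp z 2 μ)
    (h : pathCost μ ρ b z = pathCost μ ρ b fun _ => c) : z =ᵐ[μ] fun _ => c := by
  rw [pathCost_eq_const_add (Matrix.isHermitian_iff_isSymm.1 hρ.isHermitian) hc hz,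
    add_eq_left] at h
  filter_upwards [ae_eq_zero_of_pathCost_zero_left_eq_zero hρ (hz.sub (memLp_const c)) h] with a ha
  exact sub_eq_zero.1 ha

variable {Ω : Type*} {mΩ : MeasurableSpace Ω} {P : Measure Ω} {F : Ω × α → ι → ℝ}

theorem integrable_running_of_memLp (ρ : Matrix ι ι ℝ) (hF : MemLp F 2 (P.prod μ)) :
    Integrable (fun ω => ∫ a, F (ω, a) ⬝ᵥ (ρ *ᵥ F (ω, a)) ∂μ) P :=
  (integrable_dotProduct hF (memLp_mulVec hF ρ)).integral_prod_left

variable [IsFiniteMeasure P]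

theorem integrable_terminal_of_memLp (ρ : Matrix ι ι ℝ) (b : ι → ℝ) (hF : MemLp F 2 (P.prod μ)) :
    Integrable (fun ω => (b - ρ *ᵥ ∫ a, F (ω, a) ∂μ) ⬝ᵥ (b - ρ *ᵥ ∫ a, F (ω, a) ∂μ)) P := by
  have hterminal := (memLp_const b).sub
    (memLp_mulVec (memLp_integral_prod one_le_two ENNReal.ofNat_ne_top hF) ρ)
  exact integrable_dotProduct hterminal hterminal

theorem integrable_pathCost (ρ : Matrix ι ι ℝ) (b : ι → ℝ) (hF : MemLp F 2 (P.prod μ)) :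
    Integrable (fun ω => pathCost μ ρ b fun a => F (ω, a)) P :=
  ((integrable_terminal_of_memLp ρ b hF).const_mul _).add (integrable_running_of_memLp ρ hF)

theorem condExp_pathCost_ae_eq (ρ : Matrix ι ι ℝ) (b : ι → ℝ) (hF : MemLp F 2 (P.prod μ))
    (m : MeasurableSpace Ω) :
    P[fun ω => pathCost μ ρ b fun a => F (ω, a) | m] =ᵐ[P] fun ω =>
      (1 / 2) * (P[fun ω =>
        (b - ρ *ᵥ ∫ a, F (ω, a) ∂μ) ⬝ᵥ (b - ρ *ᵥ ∫ a, F (ω, a) ∂μ) | m]) ω +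
      (P[fun ω => ∫ a, F (ω, a) ⬝ᵥ (ρ *ᵥ F (ω, a)) ∂μ | m]) ω := by
  refine (condExp_add ((integrable_terminal_of_memLp ρ b hF).smul (1 / 2 : ℝ))
    (integrable_running_of_memLp ρ hF) m).trans ?_
  filter_upwards [condExp_smul (1 / 2 : ℝ) (μ := P)
    (fun ω => (b - ρ *ᵥ ∫ a, F (ω, a) ∂μ) ⬝ᵥ (b - ρ *ᵥ ∫ a, F (ω, a) ∂μ)) m] with ω hω
  rw [Pi.add_apply, hω, Pi.smul_apply, smul_eq_mul]

end PathCost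

/-! ### The cost of a strategy -/

section StrategyCost

variable {n : ℕ} {O : Mat n} {lam : Vec n} {ρ : Mat n} {T : ℝ} {x d : Vec n} {Ω : Type*}
  {ω : Ω} {X Y : Time T → Ω → Vec n} (hT : 0 < T)

/-- The path of the scaled deviation `γ^{-1/2} D`, in which the running cost has the constant
coefficient matrix `κ = ρ`. -/
noncomputable def scaledDeviation (O : Mat n) (lam : Vec n) (ρ : Mat n) (x d : Vec n)
    (X : Time T → Ω → Vec n) (ω : Ω) (s : ℝ) : Vec n :=
  impactPow O lam (-(1 / 2)) *ᵥ path hT (deviation hT O lam ρ x d X) ω s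

theorem intervalIntegrable_path_deviation
    (hX : IntervalIntegrable (path hT X ω) volume 0 T) :
    IntervalIntegrable (path hT (deviation hT O lam ρ x d X) ω) volume 0 T := by
  refine (intervalIntegrable_variationOfConstants ρ (d - impact O lam *ᵥ x)
    (intervalIntegrable_mulVec (A := fun _ => impact O lam) continuous_const hX)).congr
    fun s hs => ?_
  rw [Set.uIoc_of_le hT.le] at hs
  exact (path_deviation hT (Set.Ioc_subset_Icc_self hs)).symm

theorem impactPow_mulVec_deviation_endTime (hO : O ∈ Matrix.orthogonalGroup (Fin n) ℝ)
    (hcomm : Commute ρ (impact O lam)) (hX : IntervalIntegrable (path hT X ω) volume 0 T)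
    (hterminal : X (endTime hT) ω = 0) :
    impactPow O lam (-(1 / 2)) *ᵥ deviation hT O lam ρ x d X (endTime hT) ω =
      impactPow O lam (-(1 / 2)) *ᵥ (d - impact O lam *ᵥ x) -
        ρ *ᵥ ∫ s in Set.Icc 0 T, scaledDeviation hT O lam ρ x d X ω s := by
  have hD : IntegrableOn (path hT (deviation hT O lam ρ x d X) ω) (Set.Icc 0 T) :=
    (intervalIntegrable_iff_integrableOn_Icc_of_le hT.le).1
      (intervalIntegrable_path_deviation hT hX)
  simp only [scaledDeviation]
  rw [deviation_eq_sub_integral hT hX, hterminal, Matrix.mulVec_zero, zero_add, Matrix.mulVec_sub,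
    endTime, intervalIntegral_eq_integral_Icc hT.le, integral_mulVec _ hD, integral_mulVec _ hD,
    Matrix.mulVec_mulVec, Matrix.mulVec_mulVec, (commute_impactPow hO hcomm _).eq]

theorem path_ae_eq_of_scaledDeviation_ae_eq (hO : O ∈ Matrix.orthogonalGroup (Fin n) ℝ)
    (hlam : ∀ j, 0 < lam j) (hX : IntervalIntegrable (path hT X ω) volume 0 T)
    (hY : IntervalIntegrable (path hT Y ω) volume 0 T)
    (h : scaledDeviation hT O lam ρ x d X ω =ᵐ[volume.restrict (Set.Icc 0 T)]
      scaledDeviation hT O lam ρ x d Y ω) :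
    path hT X ω =ᵐ[volume.restrict (Set.Icc 0 T)] path hT Y ω := by
  have hD : path hT (deviation hT O lam ρ x d X) ω =ᵐ[volume.restrict (Set.Icc 0 T)]
      path hT (deviation hT O lam ρ x d Y) ω :=
    h.mono fun s hs => impactPow_mulVec_injective hO hlam _ hs
  have hintegral (r : Time T) :
      ∫ s in (0 : ℝ)..r, ρ *ᵥ path hT (deviation hT O lam ρ x d X) ω s =
        ∫ s in (0 : ℝ)..r, ρ *ᵥ path hT (deviation hT O lam ρ x d Y) ω s := by
    rw [intervalIntegral_eq_integral_Icc r.2.1, intervalIntegral_eq_integral_Icc r.2.1]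
    exact integral_congr_ae ((ae_restrict_of_ae_restrict_of_subset
      (Set.Icc_subset_Icc_right r.2.2) hD).mono fun s hs => congrArg (ρ *ᵥ ·) hs)
  filter_upwards [hD, ae_restrict_mem measurableSet_Icc] with s hs hmem
  rw [path_of_mem hT _ ω hmem, path_of_mem hT _ ω hmem, deviation_eq_sub_integral hT hX,
    deviation_eq_sub_integral hT hY, hintegral, sub_left_inj, add_left_inj, ← impactPow_one] at hs
  rw [path_of_mem hT _ ω hmem, path_of_mem hT _ ω hmem]
  exact impactPow_mulVec_injective hO hlam _ hs

variable {mΩ : MeasurableSpace Ω} {P : Measure Ω} {𝓕 : Filtration (Time T) mΩ}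

theorem memLp_scaledDeviation (hX : IsPMStrategy P hT 𝓕 O lam ρ x d X) :
    MemLp (fun p : Ω × ℝ => scaledDeviation hT O lam ρ x d X p.1 p.2) 2
      (P.prod (volume.restrict (Set.Icc 0 T))) := by
  have hmeas : Measurable fun p : Ω × ℝ => scaledDeviation hT O lam ρ x d X p.1 p.2 :=
    measurable_mulVec_comp continuous_const measurable_snd
      (measurable_path_deviation hT hX.progressive O lam ρ x d)
  refine memLp_two_of_lintegral_dotProduct_self_lt_top hmeas ?_
  rw [lintegral_prod _ (by fun_prop)]
  exact hX.deviation_integrable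

theorem ae_intervalIntegrable_path (hX : IsPMStrategy P hT 𝓕 O lam ρ x d X) :
    ∀ᵐ ω ∂P, IntervalIntegrable (path hT X ω) volume 0 T := by
  filter_upwards [hX.square_integrable] with ω hω
  have hmeas : Measurable (path hT X ω) :=
    (measurable_path hT hX.progressive).comp measurable_prodMk_left
  exact (intervalIntegrable_iff_integrableOn_Icc_of_le hT.le).2
    ((memLp_two_of_lintegral_dotProduct_self_lt_top hmeas hω).integrable one_le_two)

theorem terminalCost_ae_eq (hO : O ∈ Matrix.orthogonalGroup (Fin n) ℝ) (hlam : ∀ j, 0 < lam j)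
    (hcomm : Commute ρ (impact O lam)) (hX : IsPMStrategy P hT 𝓕 O lam ρ x d X) :
    (fun ω => deviation hT O lam ρ x d X (endTime hT) ω ⬝ᵥ
      (impactPow O lam (-1) *ᵥ deviation hT O lam ρ x d X (endTime hT) ω)) =ᵐ[P] fun ω =>
        (impactPow O lam (-(1 / 2)) *ᵥ (d - impact O lam *ᵥ x) -
          ρ *ᵥ ∫ s in Set.Icc 0 T, scaledDeviation hT O lam ρ x d X ω s) ⬝ᵥ
        (impactPow O lam (-(1 / 2)) *ᵥ (d - impact O lam *ᵥ x) -
          ρ *ᵥ ∫ s in Set.Icc 0 T, scaledDeviation hT O lam ρ x d X ω s) := by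
  filter_upwards [ae_intervalIntegrable_path hT hX, hX.terminal] with ω hint hterminal
  rw [dotProduct_impactPow_mulVec hO hlam, neg_div,
    impactPow_mulVec_deviation_endTime hT hO hcomm hint hterminal]

theorem runningCost_eq (hO : O ∈ Matrix.orthogonalGroup (Fin n) ℝ) (hlam : ∀ j, 0 < lam j)
    (hρ : ρ.IsSymm) (hcomm : Commute ρ (impact O lam)) (ω : Ω) :
    ∫ s in (0 : ℝ)..T, path hT (deviation hT O lam ρ x d X) ω s ⬝ᵥ
      ((impactPow O lam (-(1 / 2)) * kappa O lam ρ * impactPow O lam (-(1 / 2))) *ᵥ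
        path hT (deviation hT O lam ρ x d X) ω s) =
      ∫ s in Set.Icc 0 T, scaledDeviation hT O lam ρ x d X ω s ⬝ᵥ
        (ρ *ᵥ scaledDeviation hT O lam ρ x d X ω s) := by
  simp only [intervalIntegral_eq_integral_Icc hT.le, kappa_eq_self hO hlam hcomm hρ,
    dotProduct_mul_mul_mulVec (isSymm_impactPow O lam _), scaledDeviation]

variable [IsFiniteMeasure P]

theorem costPM_ae_eq (hO : O ∈ Matrix.orthogonalGroup (Fin n) ℝ) (hlam : ∀ j, 0 < lam j)
    (hρ : ρ.IsSymm) (hcomm : Commute ρ (impact O lam))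
    (hX : IsPMStrategy P hT 𝓕 O lam ρ x d X) :
    costPM P hT 𝓕 O lam ρ x d X =ᵐ[P] fun ω =>
      (P[fun ω => pathCost (volume.restrict (Set.Icc 0 T)) ρ
        (impactPow O lam (-(1 / 2)) *ᵥ (d - impact O lam *ᵥ x))
        (scaledDeviation hT O lam ρ x d X ω) | 𝓕 (startTime hT)]) ω -
      (1 / 2) * (d ⬝ᵥ (impactPow O lam (-1) *ᵥ d)) := by
  filter_upwards [condExp_congr_ae (m := 𝓕 (startTime hT)) (terminalCost_ae_eq hT hO hlam hcomm hX),
    condExp_pathCost_ae_eq ρ (impactPow O lam (-(1 / 2)) *ᵥ (d - impact O lam *ᵥ x))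
      (memLp_scaledDeviation hT hX) (𝓕 (startTime hT))] with ω hterminal hcost
  simp only [costPM, runningCost_eq hT hO hlam hρ hcomm]
  rw [hterminal, hcost]

theorem scaledDeviation_optimalStrategy_ae_eq (hO : O ∈ Matrix.orthogonalGroup (Fin n) ℝ)
    (hlam : ∀ j, 0 < lam j) (hρ : ρ.PosSemidef) (hcomm : Commute ρ (impact O lam))
    (x d : Vec n) (ω : Ω) :
    scaledDeviation hT O lam ρ x d (optimalStrategy Ω T O lam ρ x d) ω
      =ᵐ[volume.restrict (Set.Icc 0 T)]
        fun _ => impactPow O lam (-(1 / 2)) *ᵥ steadyDeviation T O lam ρ x d := by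
  filter_upwards [path_jumpAtEnd_ae_eq hT (fun _ => steadyDeviation T O lam ρ x d)
    ((2 : ℝ) • steadyDeviation T O lam ρ x d) ω] with s hs
  rw [scaledDeviation, deviation_optimalStrategy hT hO hlam hρ hcomm, hs]

end StrategyCost

/-! ### Optimality and uniqueness -/

section Optimality

theorem ae_eq_of_ae_le_of_condExp_ae_le {Ω : Type*} {m mΩ : MeasurableSpace Ω} {P : Measure Ω}
    (hm : m ≤ mΩ) [SigmaFinite (P.trim hm)] {f g : Ω → ℝ} (hf : Integrable f P)
    (hg : Integrable g P) (hle : g ≤ᵐ[P] f) (hcond : P[f | m] ≤ᵐ[P] P[g | m]) : f =ᵐ[P] g := by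
  refine ((integral_eq_iff_of_ae_le hg hf hle).1 (le_antisymm (integral_mono_ae hg hf hle) ?_)).symm
  rw [← integral_condExp (f := f) hm, ← integral_condExp (f := g) hm]
  exact integral_mono_ae integrable_condExp integrable_condExp hcond

variable {n : ℕ} {O : Mat n} {lam : Vec n} {ρ : Mat n} {T : ℝ} {x d : Vec n} {Ω : Type*}
  {mΩ : MeasurableSpace Ω} {P : Measure Ω} {𝓕 : Filtration (Time T) mΩ}
  {X Y : Time T → Ω → Vec n} (hT : 0 < T)

theorem ae_pathCost_optimalStrategy_le (hO : O ∈ Matrix.orthogonalGroup (Fin n) ℝ)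
    (hlam : ∀ j, 0 < lam j) (hρ : ρ.PosSemidef) (hcomm : Commute ρ (impact O lam))
    (hY : IsPMStrategy P hT 𝓕 O lam ρ x d Y) :
    ∀ᵐ ω ∂P,
      pathCost (volume.restrict (Set.Icc 0 T)) ρ
          (impactPow O lam (-(1 / 2)) *ᵥ (d - impact O lam *ᵥ x))
          (scaledDeviation hT O lam ρ x d (optimalStrategy Ω T O lam ρ x d) ω) ≤
        pathCost (volume.restrict (Set.Icc 0 T)) ρ
          (impactPow O lam (-(1 / 2)) *ᵥ (d - impact O lam *ᵥ x))
          (scaledDeviation hT O lam ρ x d Y ω) := by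
  filter_upwards [memLp_prodMk_left ENNReal.ofNat_ne_top (memLp_scaledDeviation hT hY)] with ω hω
  rw [pathCost_congr_ae (scaledDeviation_optimalStrategy_ae_eq hT hO hlam hρ hcomm x d ω)]
  exact pathCost_const_le hρ
    (two_smul_impactPow_mulVec_steadyDeviation_add hO hcomm hρ hT.le x d) hω

variable [IsFiniteMeasure P]

theorem isOptimalPM_optimalStrategy (hO : O ∈ Matrix.orthogonalGroup (Fin n) ℝ)
    (hlam : ∀ j, 0 < lam j) (hρ : ρ.PosSemidef) (hcomm : Commute ρ (impact O lam)) :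
    IsOptimalPM P hT 𝓕 O lam ρ x d (optimalStrategy Ω T O lam ρ x d) := by
  have hstrategy := isPMStrategy_optimalStrategy hT P hO hlam hρ hcomm 𝓕 x d
  have hsymm : ρ.IsSymm := Matrix.isHermitian_iff_isSymm.1 hρ.isHermitian
  refine ⟨hstrategy, fun Y hY => ?_⟩
  filter_upwards [costPM_ae_eq hT hO hlam hsymm hcomm hstrategy,
    costPM_ae_eq hT hO hlam hsymm hcomm hY,
    condExp_mono (m := 𝓕 (startTime hT))
      (integrable_pathCost ρ _ (memLp_scaledDeviation hT hstrategy))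
      (integrable_pathCost ρ _ (memLp_scaledDeviation hT hY))
      (ae_pathCost_optimalStrategy_le hT hO hlam hρ hcomm hY)] with ω hstar hYω hle
  rw [hstar, hYω]
  exact sub_le_sub_right hle _

theorem scaledDeviation_ae_eq_of_isOptimalPM (hO : O ∈ Matrix.orthogonalGroup (Fin n) ℝ)
    (hlam : ∀ j, 0 < lam j) (hρ : ρ.PosDef) (hcomm : Commute ρ (impact O lam))
    (hY : IsOptimalPM P hT 𝓕 O lam ρ x d Y) :
    ∀ᵐ ω ∂P, scaledDeviation hT O lam ρ x d Y ω =ᵐ[volume.restrict (Set.Icc 0 T)]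
      scaledDeviation hT O lam ρ x d (optimalStrategy Ω T O lam ρ x d) ω := by
  have hstrategy := isPMStrategy_optimalStrategy hT P hO hlam hρ.posSemidef hcomm 𝓕 x d
  have hsymm : ρ.IsSymm := Matrix.isHermitian_iff_isSymm.1 hρ.isHermitian
  have hmemLp := memLp_scaledDeviation hT hY.1
  have hcond := (costPM_ae_eq hT hO hlam hsymm hcomm hY.1).symm.trans_le
    ((hY.2 _ hstrategy).trans_eq (costPM_ae_eq hT hO hlam hsymm hcomm hstrategy))
  have hcost := ae_eq_of_ae_le_of_condExp_ae_le (𝓕.le _) (integrable_pathCost ρ _ hmemLp)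
    (integrable_pathCost ρ _ (memLp_scaledDeviation hT hstrategy))
    (ae_pathCost_optimalStrategy_le hT hO hlam hρ.posSemidef hcomm hY.1)
    (hcond.mono fun ω hω => sub_le_sub_iff_right _ |>.1 hω)
  filter_upwards [hcost, memLp_prodMk_left ENNReal.ofNat_ne_top hmemLp] with ω hω hmemω
  have hconst := scaledDeviation_optimalStrategy_ae_eq hT hO hlam hρ.posSemidef hcomm x d ω
  rw [pathCost_congr_ae hconst] at hω
  have hstationary :=
    two_smul_impactPow_mulVec_steadyDeviation_add hO hcomm hρ.posSemidef hT.le x d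
  exact (ae_eq_const_of_pathCost_eq hρ hstationary hmemω hω).trans hconst.symm

theorem path_ae_eq_of_isOptimalPM (hO : O ∈ Matrix.orthogonalGroup (Fin n) ℝ)
    (hlam : ∀ j, 0 < lam j) (hρ : ρ.PosDef) (hcomm : Commute ρ (impact O lam))
    (hY : IsOptimalPM P hT 𝓕 O lam ρ x d Y) :
    ∀ᵐ p ∂(P.prod ((volume : Measure ℝ).restrict (Set.Icc 0 T))),
      path hT Y p.1 p.2 = path hT (optimalStrategy Ω T O lam ρ x d) p.1 p.2 := by
  have hstrategy := isPMStrategy_optimalStrategy hT P hO hlam hρ.posSemidef hcomm 𝓕 x d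
  have hmeas : MeasurableSet {p : Ω × ℝ |
      path hT Y p.1 p.2 = path hT (optimalStrategy Ω T O lam ρ x d) p.1 p.2} :=
    measurableSet_eq_fun (measurable_path hT hY.1.progressive)
      (measurable_path hT hstrategy.progressive)
  refine (Measure.ae_prod_mem_iff_ae_ae_mem hmeas).2 ?_
  filter_upwards [scaledDeviation_ae_eq_of_isOptimalPM hT hO hlam hρ hcomm hY,
    ae_intervalIntegrable_path hT hY.1] with ω hω hint
  exact path_ae_eq_of_scaledDeviation_ae_eq hT hO hlam hint
    (intervalIntegrable_path_optimalStrategy hT x d ω) hω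

end Optimality

end ObizhaevaWang

open MeasureTheory ObizhaevaWang in
open scoped Matrix in
theorem mainTheorem11_general {Ω : Type*} {mΩ : MeasurableSpace Ω} (P : Measure Ω)
    [IsFiniteMeasure P] {T : ℝ} (hT : 0 < T) {n : ℕ} (𝓕 : Filtration (Time T) mΩ)
    (O : Mat n) (hO : O ∈ Matrix.orthogonalGroup (Fin n) ℝ)
    (lam : Vec n) (hlam : ∀ j, 0 < lam j)
    (ρ : Mat n) (hρ : ρ.PosDef) (hcomm : ρ * impact O lam = impact O lam * ρ)
    (x d : Vec n) :
    ∃ X : Time T → Ω → Vec n,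
      IsOptimalPM P hT 𝓕 O lam ρ x d X ∧
      (∀ Y, IsOptimalPM P hT 𝓕 O lam ρ x d Y →
        ∀ᵐ p ∂(P.prod ((volume : Measure ℝ).restrict (Set.Icc 0 T))),
          path hT Y p.1 p.2 = path hT X p.1 p.2) ∧
      IsFVStrategy P hT 𝓕 O lam ρ x d X ∧
      IsDeviationFV hT 𝓕 O lam ρ x d X (deviation hT O lam ρ x d X) ∧
      (∀ (s : Time T) (ω : Ω), (s : ℝ) < T →
        X s ω = (1 + (T - (s : ℝ)) • ρ) *ᵥ
          (((2 : ℝ) • (1 : Mat n) + T • ρ)⁻¹ *ᵥ (x - impactPow O lam (-1) *ᵥ d))) ∧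
      (∀ (s : Time T) (ω : Ω), (s : ℝ) < T →
        deviation hT O lam ρ x d X s ω =
          impactPow O lam (1 / 2) *ᵥ (((2 : ℝ) • (1 : Mat n) + T • ρ)⁻¹ *ᵥ
            (impactPow O lam (-(1 / 2)) *ᵥ d - impactPow O lam (1 / 2) *ᵥ x))) ∧
      (∀ ω : Ω,
        deviation hT O lam ρ x d X (endTime hT) ω =
          (2 : ℝ) • (impactPow O lam (1 / 2) *ᵥ (((2 : ℝ) • (1 : Mat n) + T • ρ)⁻¹ *ᵥ
            (impactPow O lam (-(1 / 2)) *ᵥ d - impactPow O lam (1 / 2) *ᵥ x)))) := by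
  have hρ' := hρ.posSemidef
  have hdev := deviation_optimalStrategy (Ω := Ω) hT hO hlam hρ' hcomm x d
  refine ⟨optimalStrategy Ω T O lam ρ x d, isOptimalPM_optimalStrategy hT hO hlam hρ' hcomm,
    fun Y hY => path_ae_eq_of_isOptimalPM hT hO hlam hρ hcomm hY,
    isFVStrategy_optimalStrategy hT P hO hlam hρ' hcomm 𝓕 x d,
    isDeviationFV_optimalStrategy hT hO hlam hρ' hcomm 𝓕 x d,
    fun _ _ hs => if_pos hs, fun _ _ hs => ?_, fun _ => ?_⟩
  · rw [hdev, ← steadyDeviation_eq hO hlam hcomm]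
    exact if_pos hs
  · rw [hdev, ← steadyDeviation_eq hO hlam hcomm]
    exact if_neg (lt_irrefl T)

open MeasureTheory ObizhaevaWang in
open scoped Matrix in
theorem mainTheorem11 {Ω : Type*} {mΩ : MeasurableSpace Ω} (P : Measure Ω)
    [IsProbabilityMeasure P] {T : ℝ} (hT : 0 < T) {n m : ℕ}
    (𝓕 : Filtration (Time T) mΩ) (W : Time T → Ω → Vec m)
    (hW : IsBrownianMotion P hT 𝓕 W) (h𝓕 : IsAugmentedNaturalFiltration P 𝓕 W)
    (O : Mat n) (hO : O ∈ Matrix.orthogonalGroup (Fin n) ℝ)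
    (lam : Vec n) (hlam : ∀ j, 0 < lam j)
    (ρ : Mat n) (hρ : ρ.PosDef) (hcomm : ρ * impact O lam = impact O lam * ρ)
    (x d : Vec n) (hd : d ≠ impact O lam *ᵥ x) :
    ∃ X : Time T → Ω → Vec n,
      IsOptimalPM P hT 𝓕 O lam ρ x d X ∧
      (∀ Y, IsOptimalPM P hT 𝓕 O lam ρ x d Y →
        ∀ᵐ p ∂(P.prod ((volume : Measure ℝ).restrict (Set.Icc 0 T))),
          path hT Y p.1 p.2 = path hT X p.1 p.2) ∧
      IsFVStrategy P hT 𝓕 O lam ρ x d X ∧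
      IsDeviationFV hT 𝓕 O lam ρ x d X (deviation hT O lam ρ x d X) ∧
      (∀ (s : Time T) (ω : Ω), (s : ℝ) < T →
        X s ω = (1 + (T - (s : ℝ)) • ρ) *ᵥ
          (((2 : ℝ) • (1 : Mat n) + T • ρ)⁻¹ *ᵥ (x - impactPow O lam (-1) *ᵥ d))) ∧
      (∀ (s : Time T) (ω : Ω), (s : ℝ) < T →
        deviation hT O lam ρ x d X s ω =
          impactPow O lam (1 / 2) *ᵥ (((2 : ℝ) • (1 : Mat n) + T • ρ)⁻¹ *ᵥ
            (impactPow O lam (-(1 / 2)) *ᵥ d - impactPow O lam (1 / 2) *ᵥ x))) ∧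
      (∀ ω : Ω,
        deviation hT O lam ρ x d X (endTime hT) ω =
          (2 : ℝ) • (impactPow O lam (1 / 2) *ᵥ (((2 : ℝ) • (1 : Mat n) + T • ρ)⁻¹ *ᵥ
            (impactPow O lam (-(1 / 2)) *ᵥ d - impactPow O lam (1 / 2) *ᵥ x)))) :=
  mainTheorem11_general P hT 𝓕 O hO lam hlam ρ hρ hcomm x d
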